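/- **Setting.** Let $G$ be a (finite-dimensional, real) Lie group and let $N,H\subseteq G$ be closed connected subgroups with $N$ normal, $G=NH$ and $N\cap H=\{e\}$, where $N$ is an exponential solvable Lie group: its Lie algebra $\mathfrak n$ is solvable and $\exp:\mathfrak n\to N$ is bijective, with inverse $\log$. Let $\mu_H$ be a left Haar measure on $H$, and let $\lambda\in\mathfrak n^*$ vanish on $[\mathfrak n,\mathfrak n]$. Let $\pi$ be the representation of $G$ on $L^2(H,d\mu_H)$ induced by the character $\exp X\mapsto e^{2\pi i\langle\lambda,X\rangle}$ of $N$, that is, $$[\pi(x)\mathbf f](h)=e^{2\pi i\langle \mathrm{Ad}(h^{-1})^*\lambda,\log x\rangle}\mathbf f(h)\ (x\in N),\qquad [\pi(z)\mathbf f](h)=\mathbf f(z^{-1}h)\ (z\in H),\qquad \pi(xz)=\pi(x)\pi(z).$$ Put $\beta_\lambda(h)=\mathrm{Ad}(h^{-1})^*\lambda\in\mathfrak n^*$ for $h\in H$, and assume that $\beta_\lambda$ is an immersion at the identity of $H$. Fix a basis $X_1,\dots,X_n$ of $\mathfrak n$ with dual basis $X_1^*,\dots,X_n^*$, and a set $J\subseteq\{1,\dots,n\}$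 with $\#J=\dim H$. Let $P:\mathfrak n\to\mathfrak n$ be the projection with $P X_k=X_k$ for $k\in J$ and $PX_k=0$ for $k\notin J$; put $\mathfrak p=P(\mathfrak n)$, and let $\mathfrak p^*=P^*(\mathfrak n^*)=\sum_{j\in J}\mathbb R X_j^*$ carry the Lebesgue measure $d\xi$ of the coordinates with respect to $(X_j^*)_{j\in J}$. Let $(\mathcal O,\varphi)$ be a smooth chart of $H$ with values in the Lie algebra $\mathfrak h$ of $H$, where $\mathcal O\ni e$ is open, connected and relatively compact and $\varphi(e)=0$, such that $\Theta_\lambda=P^*\circ\beta_\lambda\circ\varphi^{-1}$ is a diffeomorphism of $\varphi(\mathcal O)$ onto its image $\Theta_\lambda(\varphi(\mathcal O))$, which is open and relatively compact in $\mathfrak p^*$. Let $$\mathbf W_\lambda(\xi)=\frac{d\mu_H(\varphi^{-1}(\Theta_\lambda^{-1}(\xi)))}{d\xi}\in(0,\infty),\qquad \xi\in\Theta_\lambda(\varphi(\mathcal O)),$$ be the continuous version of the Radon–Nikodym derivative with respect to $d\xi$ of the image of $\mu_H|_{\mathcal O}$ under $\Theta_\lambda\circ\varphi$, and put $\mathbf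 w(h)=\mathbf W_\lambda(\Theta_\lambda(\varphi(h)))$ for $h\in\mathcal O$. Write $|C|$ for the Lebesgue measure of $C\subseteq\mathfrak p^*$. **Lemma.** Let $\mathbf s:H\to\mathbb C$ be a continuous (or a smooth) function whose support (the closure of $\{\mathbf s\neq 0\}$) is contained in $\mathcal O$. Suppose that $\Gamma_H$ is a discrete subset of $H$ such that $$\sum_{\ell\in\Gamma_H}|\mathbf s(\ell h)|^2=1\quad\text{for almost every }h\in H.$$ Let $C$ be a compact subset of $\mathfrak p^*$ with $\Theta_\lambda(\varphi(\mathcal O))\subseteq C$, and let $\Gamma_N$ be a discrete subset of $\exp(\mathfrak p)$ such that the system $\{|C|^{-1/2}e^{2\pi i\langle\xi,Y\rangle}:Y\in\log\Gamma_N\}$ is an orthonormal basis of $L^2(C,d\xi)$. Then the function $|C|^{-1/2}\mathbf s\mathbf w^{-1/2}$ (extended by $0$ outside $\mathcal O$) is continuous (smooth, if $\mathbf s$ is smooth) and compactly supported, and the system $$\left\{\pi(\ell^{-1}\kappa)\,|C|^{-1/2}\mathbf s\mathbf w^{-1/2}:(\ell,\kappa)\in\Gamma_H\times\Gamma_N\right\}$$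 is a Parseval frame of $L^2(H,d\mu_H)$, i.e. $\sum_{(\ell,\kappa)\in\Gamma_H\times\Gamma_N}|\langle\mathbf g,\pi(\ell^{-1}\kappa)|C|^{-1/2}\mathbf s\mathbf w^{-1/2}\rangle|^2=\|\mathbf g\|^2$ for every $\mathbf g\in L^2(H,d\mu_H)$. -/

import Mathlib

open MeasureTheory Set Module
open scoped Manifold ContDiff

/-! ### Frames -/

/-- A family `v` in a Hilbert space is a Parseval frame (frame bounds `A = B = 1`) if
`∑ |⟨g, v i⟩|² = ‖g‖²` for every vector `g`. -/
def IsParsevalFrame {ι F : Type*} [NormedAddCommGroup F] [InnerProductSpace ℂ F]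
    (v : ι → F) : Prop :=
  ∀ g : F, HasSum (fun i => ‖inner ℂ g (v i)‖ ^ 2) (‖g‖ ^ 2)

/-! ### The exponential map of a Lie group -/

section Exponential

variable {E : Type*} [NormedAddCommGroup E] [NormedSpace ℝ E]
  (K : Type*) [TopologicalSpace K] [ChartedSpace E K] [Group K]

/-- The Lie algebra of `K`: the tangent space at `1`, with Mathlib's bracket. -/
abbrev LieAlg : Type _ := GroupLieAlgebra 𝓘(ℝ, E) K

variable {K}

/-- `γ` is the one-parameter subgroup of `K` with initial velocity `X`. (A homomorphism from `ℝ`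
that is differentiable at `0` is smooth.) -/
def IsOneParameterSubgroup (X : LieAlg (E := E) K) (γ : ℝ → K) : Prop :=
  (∀ s t, γ (s + t) = γ s * γ t) ∧
    HasMFDerivAt 𝓘(ℝ, ℝ) 𝓘(ℝ, E) γ 0 (ContinuousLinearMap.toSpanSingleton (M₁ := E) ℝ X)

open Classical in
/-- The exponential map: `exp X = γ 1` for the one-parameter subgroup `γ` with velocity `X`
(which always exists, and is unique, in a finite-dimensional Lie group). -/
noncomputable def lieExp (X : LieAlg (E := E) K) : K :=
  if h : ∃ γ : ℝ → K, IsOneParameterSubgroup X γ then h.choose 1 else 1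

/-- The logarithm, inverse to the exponential map when the latter is bijective. -/
noncomputable def lieLog : K → LieAlg (E := E) K :=
  Function.invFun lieExp

variable (E K) in
/-- An exponential solvable Lie group: its Lie algebra is solvable and its exponential map is
bijective. -/
def IsExponentialSolvable [FiniteDimensional ℝ E] [LieGroup 𝓘(ℝ, E) ∞ K] : Prop :=
  haveI : CompleteSpace E := FiniteDimensional.complete ℝ E
  haveI : LieGroup 𝓘(ℝ, E) (minSmoothness ℝ 3) K :=
    LieGroup.of_le (n := ∞) (by simpa using ENat.LEInfty.out)
  LieAlgebra.IsSolvable (LieAlg (E := E) K) ∧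
    Function.Bijective (lieExp : LieAlg (E := E) K → K)

end Exponential

/-! ### The representation `π` and the maps built from the coadjoint action

`G` is a Lie group, `N` and `H` are subgroups with Lie group structures of their own, `N` is
normal. -/

section Induced

variable {G : Type*} [Group G] [TopologicalSpace G]
  {EN : Type*} [NormedAddCommGroup EN] [NormedSpace ℝ EN]
  {N : Subgroup G} [N.Normal] [ChartedSpace EN N] {H : Subgroup G}

variable (N) in
/-- `Ad g` on the Lie algebra of the normal subgroup `N`: the differential at `1` of
`y ↦ g y g⁻¹`. -/
noncomputable def adN (g : G) : LieAlg (E := EN) N →L[ℝ] LieAlg (E := EN) N :=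
  mfderiv 𝓘(ℝ, EN) 𝓘(ℝ, EN) (fun y : N => MulAut.conjNormal g y) 1

/-- `β_lam h = Ad (h⁻¹)^* lam`. -/
noncomputable def betaMap (lam : Dual ℝ (LieAlg (E := EN) N)) (h : H) :
    Dual ℝ (LieAlg (E := EN) N) :=
  (adN N ((h⁻¹ : H) : G)).toLinearMap.dualMap lam

/-- The representation `π` of `G = N H` induced by the character `exp X ↦ e^{2πi lam X}` of `N`,
on functions on `H`: for `g = x z` with `x ∈ N`, `z ∈ H`,
`(π g f)(h) = e^{2πi ⟨Ad(h⁻¹)^* lam, log x⟩} f(z⁻¹ h)`. In particular `π x` is a generalized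
modulation, `π z` is left translation and `π (x z) = π x ∘ π z`. -/
noncomputable def inducedRep (hNH : Subgroup.IsComplement' N H)
    (lam : Dual ℝ (LieAlg (E := EN) N)) (g : G) (f : H → ℂ) (h : H) : ℂ :=
  let x : N := ⟨((hNH.equiv g).1 : G), (hNH.equiv g).1.2⟩
  let z : H := ⟨((hNH.equiv g).2 : G), (hNH.equiv g).2.2⟩
  Complex.exp (2 * Real.pi * Complex.I * (betaMap lam h (lieLog x) : ℝ)) * f (z⁻¹ * h)

variable {n : ℕ} (X : Basis (Fin n) ℝ (LieAlg (E := EN) N)) (J : Finset (Fin n))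

/-- The projection `P = P_J` of the Lie algebra of `N`: `X_k ↦ X_k` for `k ∈ J`, `X_k ↦ 0`
otherwise. -/
noncomputable def projJ : LieAlg (E := EN) N →ₗ[ℝ] LieAlg (E := EN) N :=
  X.constr ℝ (fun k => if k ∈ J then X k else 0)

/-- `𝔭 = P(𝔫)`. Its dual `𝔭^* = P^*(𝔫^*)` is identified throughout with `J → ℝ`, through the
coordinates `ξ = ∑_{j ∈ J} ξ_j X_j^*`. -/
noncomputable def pSpace : Submodule ℝ (LieAlg (E := EN) N) :=
  LinearMap.range (projJ X J)

/-- The pairing `⟨ξ, Y⟩` of `ξ ∈ 𝔭^*` with `Y`. -/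
noncomputable def pairing (ξ : J → ℝ) (Y : LieAlg (E := EN) N) : ℝ :=
  ∑ j : J, ξ j * X.repr Y j

/-- `P^* β_lam : H → 𝔭^*`, in coordinates. -/
noncomputable def projBeta (lam : Dual ℝ (LieAlg (E := EN) N)) (h : H) : J → ℝ :=
  fun j => (projJ X J).dualMap (betaMap lam h) (X j)

/-- `Θ_lam = P^* ∘ β_lam ∘ φ⁻¹`, for a chart `φ` of `H`. -/
noncomputable def thetaMap {EH : Type*} [TopologicalSpace EH]
    (lam : Dual ℝ (LieAlg (E := EN) N)) (φ : OpenPartialHomeomorph H EH) (A : EH) : J → ℝ :=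
  projBeta X J lam (φ.symm A)

/-- `h ↦ Ad(h⁻¹)^* lam` is an immersion at the identity of `H` (its differential there is
injective); `𝔫^*` carries the coordinates of the dual basis `X_k^*`. -/
def IsImmersionAtOne {EH : Type*} [NormedAddCommGroup EH] [NormedSpace ℝ EH]
    [ChartedSpace EH H] (lam : Dual ℝ (LieAlg (E := EN) N)) : Prop :=
  Function.Injective (mfderiv 𝓘(ℝ, EH) 𝓘(ℝ, Fin n → ℝ)
    (fun (h : H) (k : Fin n) => betaMap lam h (X k)) 1)

/-- `f` restricts to a smooth diffeomorphism of the open set `s` onto an open set. -/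
def IsDiffeoOnImage {E F : Type*} [NormedAddCommGroup E] [NormedSpace ℝ E]
    [NormedAddCommGroup F] [NormedSpace ℝ F] (f : E → F) (s : Set E) : Prop :=
  ∃ e : OpenPartialHomeomorph E F, e.source = s ∧ EqOn f e s ∧
    ContDiffOn ℝ ∞ e e.source ∧ ContDiffOn ℝ ∞ e.symm e.target

/-- The chart `(𝒪, φ)`, with `𝒪 = φ.source`, of `H` at the identity: a smooth chart taking `1` to
`0` in the Lie algebra of `H` (the model space `EH`), with `𝒪` connected and relatively compact,
such that `Θ_lam` is a diffeomorphism of `φ(𝒪)` onto its image, which is relatively compact in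
`𝔭^*`. -/
structure IsAdaptedChart {EH : Type*} [NormedAddCommGroup EH] [NormedSpace ℝ EH]
    [ChartedSpace EH H] (lam : Dual ℝ (LieAlg (E := EN) N))
    (φ : OpenPartialHomeomorph H EH) : Prop where
  mem_maximalAtlas : φ ∈ IsManifold.maximalAtlas 𝓘(ℝ, EH) ∞ H
  one_mem : (1 : H) ∈ φ.source
  map_one : φ 1 = 0
  isConnected : IsConnected φ.source
  isCompact_closure : IsCompact (closure φ.source)
  card_eq : J.card = finrank ℝ EH
  diffeo : IsDiffeoOnImage (thetaMap X J lam φ) φ.target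
  isCompact_closure_image : IsCompact (closure (thetaMap X J lam φ '' φ.target))

/-! ### The density `W_lam` -/

/-- `W` is a positive, continuous Radon-Nikodym derivative on `U` of the measure `ν`, with respect
to Lebesgue measure. -/
def IsContinuousDensity {ι : Type*} [Fintype ι] (U : Set (ι → ℝ)) (ν : Measure (ι → ℝ))
    (W : (ι → ℝ) → ℝ) : Prop :=
  ContinuousOn W U ∧ (∀ ξ ∈ U, 0 < W ξ) ∧
    ν = (volume.restrict U).withDensity (fun ξ => ENNReal.ofReal (W ξ))

/-- The Radon-Nikodym derivative `W_lam(ξ) = dμ_H(φ⁻¹(Θ_lam⁻¹(ξ))) / dξ` on `Θ_lam(φ(𝒪))`, in its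
continuous version. It is unique on the open set `Θ_lam(φ(𝒪))`; the values elsewhere are
irrelevant. -/
noncomputable def densityW {EH : Type*} [TopologicalSpace EH] [MeasurableSpace H]
    (lam : Dual ℝ (LieAlg (E := EN) N)) (φ : OpenPartialHomeomorph H EH) (μ : Measure H) :
    (J → ℝ) → ℝ :=
  Classical.epsilon (IsContinuousDensity (thetaMap X J lam φ '' φ.target)
    ((μ.restrict φ.source).map (fun h => thetaMap X J lam φ (φ h))))

/-- `w(h) = W_lam(Θ_lam(φ(h)))`. -/
noncomputable def weight {EH : Type*} [TopologicalSpace EH] [MeasurableSpace H]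
    (lam : Dual ℝ (LieAlg (E := EN) N)) (φ : OpenPartialHomeomorph H EH) (μ : Measure H)
    (h : H) : ℝ :=
  densityW X J lam φ μ (thetaMap X J lam φ (φ h))

/-! ### The trigonometric system -/

/-- The system `ℰ(C, Γ)` of the functions `|C|^{-1/2} e^{2πi⟨ξ, Y⟩}`, `Y ∈ log Γ`, is an
orthonormal basis of `L²(C, dξ)`. -/
def IsExponentialONB (C : Set (J → ℝ)) (Γ : Set N) : Prop :=
  ∃ b : HilbertBasis Γ ℂ (Lp ℂ 2 (volume.restrict C)), ∀ κ : Γ,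
    b κ =ᵐ[volume.restrict C] fun ξ =>
      ((volume.real C ^ (-(1 / 2) : ℝ) : ℝ) : ℂ) *
        Complex.exp (2 * Real.pi * Complex.I * (pairing X J ξ (lieLog (κ : N)) : ℝ))

/-- The generator `|C|^{-1/2} s w^{-1/2}`. -/
noncomputable def generator {EH : Type*} [TopologicalSpace EH] [MeasurableSpace H]
    (lam : Dual ℝ (LieAlg (E := EN) N)) (φ : OpenPartialHomeomorph H EH) (μ : Measure H)
    (C : Set (J → ℝ)) (s : H → ℂ) (h : H) : ℂ :=
  ((volume.real C ^ (-(1 / 2) : ℝ) : ℝ) : ℂ) * s h *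
    ((weight X J lam φ μ h ^ (-(1 / 2) : ℝ) : ℝ) : ℂ)

end Induced

/-! Write `f` for the generator and ψ = Θ_λ ∘ φ for the resulting chart of H with values in 𝔭*.
Since ℓ⁻¹κ = (ℓ⁻¹κℓ)ℓ⁻¹ and log(ℓ⁻¹κℓ) = Ad(ℓ⁻¹) log κ, one gets [π(ℓ⁻¹κ)f](h) = e^{2πi⟨β_λ(ℓh), log
κ⟩} f(ℓh) (`inducedRep_inv_mul`). By left invariance, the coefficient of g is an integral over 𝒪 of
the conjugate of g(ℓ⁻¹h) times e^{2πi⟨β_λ(h), log κ⟩} f(h). Because log κ lies in 𝔭, the phase is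
⟨ψ(h), log κ⟩. With dμ_H = W dξ, the coefficient becomes the inner product over C of the function
g(ℓ⁻¹·) s̄ W^{1/2}, extended by zero, with a member of the exponential basis. Parseval in L²(C) then
gives ∫ |g(ℓ⁻¹h)|² |s(h)|² dμ_H as the sum over κ (`hasSum_sq_norm_integral_chart`). Summing over ℓ,
left invariance and ∑ |s(ℓh)|² = 1 give ‖g‖² (`hasSum_integral_translate`).

Two inputs need real work. First, N carries its own Lie structure, so conjugation must be shown
differentiable for it: injectivity of exp makes the inclusion into G an immersion at the identity,
through which differentiability descends. Second, W is a chosen value that means something only if a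
positive continuous density exists. One is built from the Jacobians of left translations, extended
to a left invariant measure on H, and compared with μ_H by uniqueness of Haar measure
(`exists_contDiffOn_density_haar`). It is even smooth, which settles the regularity of the
generator. -/

section OneParameter

/-! ### One-parameter subgroups, exponential and logarithm -/

variable {E : Type*} [NormedAddCommGroup E] [NormedSpace ℝ E]
  {K : Type*} [TopologicalSpace K] [ChartedSpace E K] [Group K]

theorem IsOneParameterSubgroup.map_zero {X : LieAlg (E := E) K} {γ : ℝ → K}
    (hγ : IsOneParameterSubgroup X γ) : γ 0 = 1 := by
  have h := hγ.1 0 0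
  rw [add_zero] at h
  exact left_eq_mul.mp h

/-- Differentiate γ(u) = γ(t) γ(u - t) at u = t. Uniqueness of integral curves then gives uniqueness
of one-parameter subgroups. -/
theorem IsOneParameterSubgroup.isMIntegralCurve [LieGroup 𝓘(ℝ, E) ∞ K] {X : LieAlg (E := E) K}
    {γ : ℝ → K} (hγ : IsOneParameterSubgroup X γ) :
    IsMIntegralCurve (I := 𝓘(ℝ, E)) γ (mulInvariantVectorField X) := by
  intro t
  have h0 := hγ.map_zero
  have hsub : HasMFDerivAt 𝓘(ℝ, ℝ) 𝓘(ℝ, ℝ) (fun u : ℝ => u - t) t (ContinuousLinearMap.id ℝ ℝ) :=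
    ((hasFDerivAt_id t).sub_const t).hasMFDerivAt
  have hγ' : HasMFDerivAt 𝓘(ℝ, ℝ) 𝓘(ℝ, E) γ (t - t)
      (ContinuousLinearMap.toSpanSingleton (M₁ := E) ℝ X) := by
    rw [sub_self]; exact hγ.2
  have hL : HasMFDerivAt 𝓘(ℝ, E) 𝓘(ℝ, E) (fun y : K => γ t * y) (γ (t - t))
      (mfderiv 𝓘(ℝ, E) 𝓘(ℝ, E) (fun y : K => γ t * y) (γ (t - t))) :=
    ((contMDiff_mul_left (I := 𝓘(ℝ, E)) (n := ∞)).mdifferentiableAt (by simp)).hasMFDerivAt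
  have h := HasMFDerivAt.comp (f := fun u : ℝ => u - t) t (hL.comp (t - t) hγ') hsub
  have heq : ((fun y : K => γ t * y) ∘ γ) ∘ (fun u : ℝ => u - t) = γ := by
    funext u
    simp [← hγ.1]
  rw [heq] at h
  refine h.congr_mfderiv ?_
  rw [sub_self, h0]
  refine ContinuousLinearMap.ext fun r => ?_
  exact (mfderiv 𝓘(ℝ, E) 𝓘(ℝ, E) (fun y : K => γ t * y) 1).map_smul (r : ℝ) X

theorem IsOneParameterSubgroup.unique [FiniteDimensional ℝ E] [T2Space K] [LieGroup 𝓘(ℝ, E) ∞ K]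
    {X : LieAlg (E := E) K} {γ γ' : ℝ → K} (hγ : IsOneParameterSubgroup X γ)
    (hγ' : IsOneParameterSubgroup X γ') : γ = γ' := by
  have : CompleteSpace E := FiniteDimensional.complete ℝ E
  have : LieGroup 𝓘(ℝ, E) (minSmoothness ℝ 3) K :=
    LieGroup.of_le (n := ∞) (by simpa using ENat.LEInfty.out)
  have : IsManifold 𝓘(ℝ, E) 1 K := IsManifold.of_le (n := ∞) (by simp)
  refine isMIntegralCurve_Ioo_eq_of_contMDiff_boundaryless (I := 𝓘(ℝ, E)) (t₀ := 0) ?_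
    hγ.isMIntegralCurve hγ'.isMIntegralCurve (hγ.map_zero.trans hγ'.map_zero.symm)
  exact (contMDiff_mulInvariantVectorField X).of_le (by simp)

theorem isOneParameterSubgroup_zero : IsOneParameterSubgroup (0 : LieAlg (E := E) K)
    (fun _ : ℝ => (1 : K)) := by
  refine ⟨by simp, ?_⟩
  refine (hasMFDerivAt_const (I := 𝓘(ℝ, ℝ)) (I' := 𝓘(ℝ, E)) (1 : K) (0 : ℝ)).congr_mfderiv ?_
  exact ((ContinuousLinearMap.toSpanSingleton_zero ℝ : _ = (0 : ℝ →L[ℝ] E))).symm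

theorem IsOneParameterSubgroup.map {E' K' : Type*} [NormedAddCommGroup E'] [NormedSpace ℝ E']
    [TopologicalSpace K'] [ChartedSpace E' K'] [Group K'] {X : LieAlg (E := E) K} {γ : ℝ → K}
    (hγ : IsOneParameterSubgroup X γ) (f : K →* K')
    {f' : E →L[ℝ] E'} (hf : HasMFDerivAt 𝓘(ℝ, E) 𝓘(ℝ, E') f 1 f') :
    IsOneParameterSubgroup (K := K') (E := E') (f' X) (f ∘ γ) := by
  refine ⟨fun s t => by simp [hγ.1], ?_⟩
  have hf1 : HasMFDerivAt 𝓘(ℝ, E) 𝓘(ℝ, E') f (γ 0) f' := by rw [hγ.map_zero]; exact hf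
  refine (hf1.comp 0 hγ.2).congr_mfderiv ?_
  exact ContinuousLinearMap.comp_toSpanSingleton f' (X : E)

theorem lieExp_eq [FiniteDimensional ℝ E] [T2Space K] [LieGroup 𝓘(ℝ, E) ∞ K]
    {X : LieAlg (E := E) K} {γ : ℝ → K} (hγ : IsOneParameterSubgroup X γ) :
    lieExp X = γ 1 := by
  have h : ∃ γ : ℝ → K, IsOneParameterSubgroup X γ := ⟨γ, hγ⟩
  rw [lieExp, dif_pos h, h.choose_spec.unique hγ]

/-- The default value 1 of `lieExp` does the work: if X had no one-parameter subgroup, then exp X =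
1 = exp 0, so X = 0 by injectivity, and 0 has the constant one. No flow has to be constructed. -/
theorem exists_isOneParameterSubgroup [FiniteDimensional ℝ E] [T2Space K]
    [LieGroup 𝓘(ℝ, E) ∞ K] (hinj : Function.Injective (lieExp : LieAlg (E := E) K → K))
    (X : LieAlg (E := E) K) : ∃ γ : ℝ → K, IsOneParameterSubgroup X γ := by
  by_contra h
  have h1 : lieExp X = 1 := by rw [lieExp, dif_neg h]
  have h2 : X = 0 := hinj (h1.trans (lieExp_eq isOneParameterSubgroup_zero).symm)
  exact h (h2 ▸ ⟨_, isOneParameterSubgroup_zero⟩)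

/-- Homomorphisms carry one-parameter subgroups to one-parameter subgroups, so f ∘ exp = exp ∘ f'.
-/
theorem lieLog_map [FiniteDimensional ℝ E] [T2Space K] [LieGroup 𝓘(ℝ, E) ∞ K]
    (hbij : Function.Bijective (lieExp : LieAlg (E := E) K → K)) (f : K →* K)
    {f' : LieAlg (E := E) K →L[ℝ] LieAlg (E := E) K}
    (hf : HasMFDerivAt 𝓘(ℝ, E) 𝓘(ℝ, E) f 1 (f' : E →L[ℝ] E)) (x : K) :
    lieLog (f x) = f' (lieLog x) := by
  obtain ⟨Y, rfl⟩ := hbij.2 x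
  obtain ⟨γ, hγ⟩ := exists_isOneParameterSubgroup hbij.1 Y
  have h : f (lieExp Y) = lieExp (f' Y) := by
    rw [lieExp_eq hγ]; exact (lieExp_eq (hγ.map f hf)).symm
  rw [h, lieLog, Function.leftInverse_invFun hbij.1, Function.leftInverse_invFun hbij.1]

/-- If f' X = 0, then f ∘ γ has velocity 0 and is constant. Injectivity of f gives exp X = 1 = exp
0, and injectivity of exp gives X = 0. -/
theorem mfderiv_injective_of_injective {E' K' : Type*} [NormedAddCommGroup E'] [NormedSpace ℝ E']
    [FiniteDimensional ℝ E] [T2Space K] [LieGroup 𝓘(ℝ, E) ∞ K]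
    [FiniteDimensional ℝ E'] [TopologicalSpace K'] [T2Space K'] [ChartedSpace E' K'] [Group K']
    [LieGroup 𝓘(ℝ, E') ∞ K']
    (hexp : Function.Injective (lieExp : LieAlg (E := E) K → K)) (f : K →* K')
    (hinj : Function.Injective f)
    {f' : E →L[ℝ] E'} (hf : HasMFDerivAt 𝓘(ℝ, E) 𝓘(ℝ, E') f 1 f') :
    Function.Injective f' := by
  rw [injective_iff_map_eq_zero]
  intro X hX
  obtain ⟨γ, hγ⟩ := exists_isOneParameterSubgroup hexp X
  have h1 := hγ.map f hf
  rw [hX] at h1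
  have h2 := h1.unique isOneParameterSubgroup_zero
  apply hexp
  rw [lieExp_eq hγ]
  refine Eq.trans (hinj ?_) (lieExp_eq (isOneParameterSubgroup_zero (E := E) (K := K))).symm
  rw [map_one]
  exact congrFun h2 1

end OneParameter

/-! ### Differentiability through an immersion -/

/-- An immersion has a local differentiable left inverse: compose g, read in charts, with a linear
left inverse of g' and apply the inverse function theorem. Near x, f is this left inverse applied to
g ∘ f; continuity of f keeps f(y) where the inverse is valid. -/
theorem mdifferentiableAt_of_comp_immersion {E F E' M N M' : Type*}
    [NormedAddCommGroup E] [NormedSpace ℝ E] [NormedAddCommGroup F] [NormedSpace ℝ F]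
    [FiniteDimensional ℝ F] [NormedAddCommGroup E'] [NormedSpace ℝ E'] [FiniteDimensional ℝ E']
    [TopologicalSpace M] [ChartedSpace E M] [TopologicalSpace N] [ChartedSpace F N]
    [TopologicalSpace M'] [ChartedSpace E' M'] [IsManifold 𝓘(ℝ, F) ∞ N] [IsManifold 𝓘(ℝ, E') ∞ M']
    {f : M → N} {g : N → M'} {x : M} {y : N} (hxy : f x = y)
    {g' : F →L[ℝ] E'} (hg : ContMDiffAt 𝓘(ℝ, F) 𝓘(ℝ, E') ∞ g y)
    (hg' : HasMFDerivAt 𝓘(ℝ, F) 𝓘(ℝ, E') g y g') (hinj : Function.Injective g')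
    (hf : ContinuousAt f x) (hgf : MDifferentiableAt 𝓘(ℝ, E) 𝓘(ℝ, E') (g ∘ f) x) :
    MDifferentiableAt 𝓘(ℝ, E) 𝓘(ℝ, F) f x := by
  subst hxy
  have : CompleteSpace F := FiniteDimensional.complete ℝ F
  set W := writtenInExtChartAt 𝓘(ℝ, F) 𝓘(ℝ, E') (f x) g with hW
  set p := extChartAt 𝓘(ℝ, F) (f x) (f x) with hp
  have hWd : HasFDerivAt W g' p := by
    have := hg'.2
    rw [ModelWithCorners.range_eq_univ] at this
    exact hasFDerivWithinAt_univ.1 this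
  have hWc : ContDiffAt ℝ ∞ W p := by
    have := (contMDiffAt_iff.1 hg).2
    rwa [ModelWithCorners.range_eq_univ, contDiffWithinAt_univ] at this
  have hWs : HasStrictFDerivAt W g' p := hWc.hasStrictFDerivAt' hWd (by simp)
  obtain ⟨L, hL⟩ := g'.toLinearMap.exists_leftInverse_of_injective (LinearMap.ker_eq_bot.2 hinj)
  set Lc : E' →L[ℝ] F := LinearMap.toContinuousLinearMap L
  have hS : HasStrictFDerivAt (Lc ∘ W) ((ContinuousLinearEquiv.refl ℝ F : F ≃L[ℝ] F) : F →L[ℝ] F) p := by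
    have hLc : ((ContinuousLinearEquiv.refl ℝ F : F ≃L[ℝ] F) : F →L[ℝ] F) = Lc.comp g' :=
      ContinuousLinearMap.ext fun v => (LinearMap.congr_fun hL v).symm
    rw [hLc]
    exact Lc.hasStrictFDerivAt.comp p hWs
  set k := hS.localInverse (Lc ∘ W) _ p
  have hk : DifferentiableAt ℝ k (Lc (W p)) := hS.to_localInverse.hasFDerivAt.differentiableAt
  have hq : ContinuousAt (fun y => extChartAt 𝓘(ℝ, F) (f x) (f y)) x :=
    (continuousAt_extChartAt (I := 𝓘(ℝ, F)) (f x)).comp hf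
  have hcg : ContinuousAt (g ∘ f) x := hg.continuousAt.comp hf
  have hsrc : ∀ᶠ y in nhds x, f y ∈ (extChartAt 𝓘(ℝ, F) (f x)).source :=
    hf.eventually (extChartAt_source_mem_nhds (I := 𝓘(ℝ, F)) (f x))
  have heq : ∀ᶠ y in nhds x, (extChartAt 𝓘(ℝ, F) (f x)).symm
      (k (Lc (extChartAt 𝓘(ℝ, E') (g (f x)) (g (f y))))) = f y := by
    filter_upwards [hsrc, hq.eventually hS.eventually_left_inverse] with y hy hy2
    have h3 : W (extChartAt 𝓘(ℝ, F) (f x) (f y)) = extChartAt 𝓘(ℝ, E') (g (f x)) (g (f y)) := by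
      simp only [hW, writtenInExtChartAt, Function.comp_apply]
      rw [(extChartAt 𝓘(ℝ, F) (f x)).left_inv hy]
    rw [← h3]
    exact (congrArg _ hy2).trans ((extChartAt 𝓘(ℝ, F) (f x)).left_inv hy)
  have hWp : W p = extChartAt 𝓘(ℝ, E') (g (f x)) (g (f x)) := by
    simp only [hW, hp, writtenInExtChartAt, Function.comp_apply, extChartAt_to_inv]
  have hkp : k (Lc (W p)) = p := hS.eventually_left_inverse.self_of_nhds
  have h1 : MDifferentiableAt 𝓘(ℝ, E) 𝓘(ℝ, E')
      (extChartAt 𝓘(ℝ, E') (g (f x)) ∘ (g ∘ f)) x :=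
    ((contMDiffAt_extChartAt (I := 𝓘(ℝ, E')) (n := ∞) (x := g (f x))).mdifferentiableAt
      (by simp)).comp x hgf
  have h2 : MDifferentiableAt 𝓘(ℝ, E') 𝓘(ℝ, F) (k ∘ Lc) ((extChartAt 𝓘(ℝ, E') (g (f x)) ∘ (g ∘ f)) x) := by
    refine DifferentiableAt.mdifferentiableAt (DifferentiableAt.comp _ ?_ Lc.differentiableAt)
    simp only [Function.comp_apply]
    rw [← hWp]; exact hk
  have h3 : MDifferentiableAt 𝓘(ℝ, F) 𝓘(ℝ, F) (extChartAt 𝓘(ℝ, F) (f x)).symm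
      (((k ∘ Lc) ∘ (extChartAt 𝓘(ℝ, E') (g (f x)) ∘ (g ∘ f))) x) := by
    simp only [Function.comp_apply]
    rw [← hWp, hkp]
    exact ((contMDiffOn_extChartAt_symm (I := 𝓘(ℝ, F)) (n := ∞) (f x)).contMDiffAt
      (extChartAt_target_mem_nhds (f x))).mdifferentiableAt (by simp)
  exact (h3.comp x (h2.comp x h1)).congr_of_eventuallyEq (by
    filter_upwards [heq] with y hy using hy.symm)

/-! ### The adjoint action on 𝔫 and the formula for π(ℓ⁻¹κ) -/

section Adjoint

variable {EG EN : Type*}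
    [NormedAddCommGroup EG] [NormedSpace ℝ EG] [FiniteDimensional ℝ EG]
    [NormedAddCommGroup EN] [NormedSpace ℝ EN] [FiniteDimensional ℝ EN]
    {G : Type*} [TopologicalSpace G] [T2Space G] [ChartedSpace EG G] [Group G]
    [LieGroup 𝓘(ℝ, EG) ∞ G]
    {N : Subgroup G} [N.Normal]
    [ChartedSpace EN N] [LieGroup 𝓘(ℝ, EN) ∞ N]

/-- Without this, `adN` could be the default value 0 of `mfderiv`. Conjugation is smooth as a map
from N into G, and the inclusion of N is an immersion at 1. -/
theorem mdifferentiableAt_conjNormal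
    (hNsmooth : ContMDiff 𝓘(ℝ, EN) 𝓘(ℝ, EG) ∞ (fun x : N => (x : G)))
    (hinj : Function.Injective (lieExp : LieAlg (E := EN) N → N)) (g : G) :
    MDifferentiableAt 𝓘(ℝ, EN) 𝓘(ℝ, EN) (fun y : N => MulAut.conjNormal g y) 1 := by
  have : IsTopologicalGroup G := topologicalGroup_of_lieGroup 𝓘(ℝ, EG) ∞
  have hd := fun x : N => ((hNsmooth x).mdifferentiableAt (by simp)).hasMFDerivAt
  refine mdifferentiableAt_of_comp_immersion (y := 1) (g := fun x : N => (x : G)) (map_one _)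
    (hNsmooth _) (hd _) ?_ ?_ ?_
  · exact mfderiv_injective_of_injective hinj N.subtype N.subtype_injective (hd 1)
  · refine Continuous.continuousAt (Continuous.subtype_mk (f := fun y : N => g * y * g⁻¹) ?_ _)
    fun_prop
  · have h : ContMDiff 𝓘(ℝ, EN) 𝓘(ℝ, EG) ∞ (fun y : N => g * (y : G) * g⁻¹) :=
      (contMDiff_const.mul hNsmooth).mul contMDiff_const
    exact (h 1).mdifferentiableAt (by simp)

theorem hasMFDerivAt_conjNormal
    (hNsmooth : ContMDiff 𝓘(ℝ, EN) 𝓘(ℝ, EG) ∞ (fun x : N => (x : G)))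
    (hinj : Function.Injective (lieExp : LieAlg (E := EN) N → N)) (g : G) :
    HasMFDerivAt 𝓘(ℝ, EN) 𝓘(ℝ, EN) (fun y : N => MulAut.conjNormal g y) 1
      (adN (EN := EN) N g : EN →L[ℝ] EN) :=
  (mdifferentiableAt_conjNormal hNsmooth hinj g).hasMFDerivAt

theorem adN_mul (hNsmooth : ContMDiff 𝓘(ℝ, EN) 𝓘(ℝ, EG) ∞ (fun x : N => (x : G)))
    (hinj : Function.Injective (lieExp : LieAlg (E := EN) N → N)) (a b : G)
    (Y : LieAlg (E := EN) N) :
    adN (EN := EN) N (a * b) Y = adN (EN := EN) N a (adN (EN := EN) N b Y) := by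
  have hb := hasMFDerivAt_conjNormal hNsmooth hinj b
  have ha : HasMFDerivAt 𝓘(ℝ, EN) 𝓘(ℝ, EN) (fun y : N => MulAut.conjNormal a y)
      ((fun y : N => MulAut.conjNormal b y) 1) (adN (EN := EN) N a : EN →L[ℝ] EN) := by
    have hone : (fun y : N => MulAut.conjNormal b y) 1 = 1 := map_one _
    rw [hone]
    exact hasMFDerivAt_conjNormal hNsmooth hinj a
  have h := ha.comp 1 hb
  have h' := hasMFDerivAt_conjNormal hNsmooth hinj (a * b)
  have heq : (fun y : N => MulAut.conjNormal (a * b) y) =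
      (fun y : N => MulAut.conjNormal a y) ∘ (fun y : N => MulAut.conjNormal b y) := by
    funext y; simp
  rw [heq] at h'
  exact congrArg (fun T : EN →L[ℝ] EN => T Y) (hasMFDerivAt_unique h' h)

theorem lieLog_conjNormal (hNsmooth : ContMDiff 𝓘(ℝ, EN) 𝓘(ℝ, EG) ∞ (fun x : N => (x : G)))
    (hbij : Function.Bijective (lieExp : LieAlg (E := EN) N → N)) (g : G) (x : N) :
    lieLog (MulAut.conjNormal g x) = adN (EN := EN) N g (lieLog x) :=
  lieLog_map hbij (MulAut.conjNormal g : MulAut N).toMonoidHom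
    (hasMFDerivAt_conjNormal hNsmooth hbij.1 g) x

/-- The N-part of ℓ⁻¹κ is ℓ⁻¹κℓ and its H-part is ℓ⁻¹. The factor Ad(ℓ⁻¹) from the logarithm
combines with Ad(h⁻¹) into Ad((ℓh)⁻¹), so the whole expression is a function of ℓh. -/
theorem inducedRep_inv_mul {H : Subgroup G}
    (hNsmooth : ContMDiff 𝓘(ℝ, EN) 𝓘(ℝ, EG) ∞ (fun x : N => (x : G)))
    (hbij : Function.Bijective (lieExp : LieAlg (E := EN) N → N))
    (hNH : Subgroup.IsComplement' N H) (lam : Module.Dual ℝ (LieAlg (E := EN) N))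
    (l : H) (κ : N) (f : H → ℂ) (h : H) :
    inducedRep hNH lam ((l : G)⁻¹ * (κ : G)) f h =
      Complex.exp (2 * Real.pi * Complex.I * (betaMap lam (l * h) (lieLog κ) : ℝ)) * f (l * h) := by
  have hsplit : ((l : G)⁻¹ * (κ : G)) =
      ((MulAut.conjNormal ((l : G)⁻¹) κ : N) : G) * ((l⁻¹ : H) : G) := by
    simp [mul_assoc]
  have heq : hNH.equiv ((l : G)⁻¹ * (κ : G)) =
      (MulAut.conjNormal ((l : G)⁻¹) κ, l⁻¹) := by
    rw [← Equiv.eq_symm_apply]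
    apply hsplit.trans
    rfl
  have hbeta : betaMap lam h (lieLog (MulAut.conjNormal ((l : G)⁻¹) κ)) =
      betaMap lam (l * h) (lieLog κ) := by
    rw [lieLog_conjNormal hNsmooth hbij]
    simp only [betaMap, LinearMap.dualMap_apply, ContinuousLinearMap.coe_coe]
    rw [← adN_mul hNsmooth hbij.1]
    simp [mul_inv_rev]
  have hinv : (⟨((l⁻¹ : H) : G), (l⁻¹).2⟩ : H)⁻¹ = l := inv_inv l
  simp only [inducedRep, heq]
  rw [hinv, ← hbeta]

end Adjoint

/-! ### The density of Haar measure in a chart -/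

theorem contDiff_continuousLinearMap_det {ι : Type*} [Fintype ι] {k : ℕ∞ω} :
    ContDiff ℝ k (fun T : (ι → ℝ) →L[ℝ] (ι → ℝ) => T.det) := by
  classical
  have h : (fun T : (ι → ℝ) →L[ℝ] (ι → ℝ) => T.det) = fun T =>
      ∑ σ : Equiv.Perm ι, ((Equiv.Perm.sign σ : ℤ) : ℝ) * ∏ i, T (Pi.single i 1) (σ i) := by
    funext T
    rw [ContinuousLinearMap.det, ← LinearMap.det_toMatrix', Matrix.det_apply']
    simp [LinearMap.toMatrix'_apply]
  rw [h]
  refine ContDiff.sum fun σ _ => contDiff_const.mul (contDiff_prod fun i _ => ?_)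
  exact contDiff_pi.1 (contDiff_id.clm_apply contDiff_const) (σ i)

section ChartHaar

variable {ι : Type*} [Fintype ι] {E : Type*} [NormedAddCommGroup E] [NormedSpace ℝ E]
  {H : Type*} [TopologicalSpace H] [ChartedSpace E H] [Group H]

/-- Left translation by `h`, read in the chart `ψ`. -/
def chartTransl (ψ : OpenPartialHomeomorph H (ι → ℝ)) (h : H) (z : ι → ℝ) : ι → ℝ :=
  ψ (h * ψ.symm z)

/-- The absolute value of the Jacobian determinant at the identity of the left translation by `h`,
read in the chart `ψ`. -/
noncomputable def chartJac (ψ : OpenPartialHomeomorph H (ι → ℝ)) (h : H) : ℝ :=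
  |(fderiv ℝ (chartTransl ψ h) (ψ 1)).det|

/-- The density, in the chart `ψ`, of the left invariant measure normalized to have density `1` at
the identity. -/
noncomputable def chartHaarDensity (ψ : OpenPartialHomeomorph H (ι → ℝ)) (ξ : ι → ℝ) : ℝ :=
  (chartJac ψ (ψ.symm ξ))⁻¹

/-- The left invariant measure on the domain of the chart `ψ` with density `chartHaarDensity`. -/
noncomputable def chartHaar [MeasurableSpace H] (ψ : OpenPartialHomeomorph H (ι → ℝ)) :
    Measure H :=
  ((volume.restrict ψ.target).withDensity
    (fun ξ => ENNReal.ofReal (chartHaarDensity ψ ξ))).map ψ.symm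

/-- `ψ` is a smooth chart of `H` whose domain contains the identity. -/
structure IsSmoothChartAtOne (E : Type*) [NormedAddCommGroup E] [NormedSpace ℝ E]
    {H : Type*} [TopologicalSpace H] [ChartedSpace E H] [Group H]
    (ψ : OpenPartialHomeomorph H (ι → ℝ)) : Prop where
  one_mem : (1 : H) ∈ ψ.source
  contMDiffOn : ContMDiffOn 𝓘(ℝ, E) 𝓘(ℝ, ι → ℝ) ∞ ψ ψ.source
  contMDiffOn_symm : ContMDiffOn 𝓘(ℝ, ι → ℝ) 𝓘(ℝ, E) ∞ ψ.symm ψ.target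

variable {ψ : OpenPartialHomeomorph H (ι → ℝ)} [LieGroup 𝓘(ℝ, E) ∞ H]

theorem contDiffAt_chartTransl (hψ : IsSmoothChartAtOne E ψ) {h : H} {z : ι → ℝ}
    (hz : z ∈ ψ.target) (hhz : h * ψ.symm z ∈ ψ.source) : ContDiffAt ℝ ∞ (chartTransl ψ h) z := by
  rw [← contMDiffAt_iff_contDiffAt]
  have h1 : ContMDiffAt 𝓘(ℝ, ι → ℝ) 𝓘(ℝ, E) ∞ (fun z => h * ψ.symm z) z :=
    contMDiffAt_const.mul (hψ.contMDiffOn_symm.contMDiffAt (ψ.open_target.mem_nhds hz))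
  exact (hψ.contMDiffOn.contMDiffAt (ψ.open_source.mem_nhds hhz)).comp z h1

theorem contDiffAt_uncurry_chartTransl (hψ : IsSmoothChartAtOne E ψ) {ξ z : ι → ℝ}
    (hξ : ξ ∈ ψ.target) (hz : z ∈ ψ.target) (hhz : ψ.symm ξ * ψ.symm z ∈ ψ.source) :
    ContDiffAt ℝ ∞ (Function.uncurry fun ξ => chartTransl ψ (ψ.symm ξ)) (ξ, z) := by
  rw [← contMDiffAt_iff_contDiffAt]
  have h1 : ContMDiffAt 𝓘(ℝ, (ι → ℝ) × (ι → ℝ)) 𝓘(ℝ, E) ∞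
      (fun p : (ι → ℝ) × (ι → ℝ) => ψ.symm p.1 * ψ.symm p.2) (ξ, z) := by
    refine ContMDiffAt.mul ?_ ?_
    · exact (hψ.contMDiffOn_symm.contMDiffAt (ψ.open_target.mem_nhds hξ)).comp
        (f := Prod.fst) (ξ, z) contDiff_fst.contMDiff.contMDiffAt
    · exact (hψ.contMDiffOn_symm.contMDiffAt (ψ.open_target.mem_nhds hz)).comp
        (f := Prod.snd) (ξ, z) contDiff_snd.contMDiff.contMDiffAt
  exact (hψ.contMDiffOn.contMDiffAt (ψ.open_source.mem_nhds hhz)).comp (ξ, z) h1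

/-- Chain rule at the identity for left translation by a product; the factorization in the chart
holds only near ψ(1), which suffices for the derivative. -/
theorem chartJac_mul (hψ : IsSmoothChartAtOne E ψ) {h : H} {z : ι → ℝ} (hz : z ∈ ψ.target)
    (hhz : h * ψ.symm z ∈ ψ.source) :
    chartJac ψ (h * ψ.symm z) = |(fderiv ℝ (chartTransl ψ h) z).det| * chartJac ψ (ψ.symm z) := by
  have : IsTopologicalGroup H := topologicalGroup_of_lieGroup 𝓘(ℝ, E) ∞
  have h1 : ψ 1 ∈ ψ.target := ψ.map_source hψ.one_mem
  have hz1 : chartTransl ψ (ψ.symm z) (ψ 1) = z := by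
    simp [chartTransl, ψ.left_inv hψ.one_mem, ψ.right_inv hz]
  have hd : DifferentiableAt ℝ (chartTransl ψ (ψ.symm z)) (ψ 1) := by
    refine (contDiffAt_chartTransl hψ h1 ?_).differentiableAt (by simp)
    simpa [ψ.left_inv hψ.one_mem] using ψ.map_target hz
  have hd' : DifferentiableAt ℝ (chartTransl ψ h) (chartTransl ψ (ψ.symm z) (ψ 1)) := by
    rw [hz1]
    exact (contDiffAt_chartTransl hψ hz hhz).differentiableAt (by simp)
  have hc : ContinuousAt (fun w => ψ.symm z * ψ.symm w) (ψ 1) :=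
    continuousAt_const.mul (ψ.continuousAt_symm h1)
  have hmem : ψ.symm z * ψ.symm (ψ 1) ∈ ψ.source := by
    simpa [ψ.left_inv hψ.one_mem] using ψ.map_target hz
  have heq : chartTransl ψ (h * ψ.symm z) =ᶠ[nhds (ψ 1)]
      chartTransl ψ h ∘ chartTransl ψ (ψ.symm z) := by
    filter_upwards [hc.eventually (ψ.open_source.mem_nhds hmem)] with w hw
    simp only [chartTransl, Function.comp_apply]
    rw [ψ.left_inv hw, mul_assoc]
  rw [chartJac, heq.fderiv_eq, fderiv_comp _ hd' hd, hz1, chartJac, ← abs_mul]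
  exact congrArg _ (LinearMap.det_comp _ _)

theorem chartJac_one (hψ : IsSmoothChartAtOne E ψ) : chartJac ψ (1 : H) = 1 := by
  have heq : chartTransl ψ (1 : H) =ᶠ[nhds (ψ 1)] id := by
    filter_upwards [ψ.open_target.mem_nhds (ψ.map_source hψ.one_mem)] with w hw
    simp [chartTransl, ψ.right_inv hw]
  rw [chartJac, heq.fderiv_eq, fderiv_id]
  simp [ContinuousLinearMap.det]

theorem chartJac_pos (hψ : IsSmoothChartAtOne E ψ) {z : ι → ℝ} (hz : z ∈ ψ.target) :
    0 < chartJac ψ (ψ.symm z) := by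
  refine (abs_nonneg _).lt_of_ne fun h0 => ?_
  -- Translating back to the identity exhibits the Jacobian as a factor of 1, so it cannot vanish.
  have h := chartJac_mul hψ (h := (ψ.symm z)⁻¹) hz (by simpa using hψ.one_mem)
  have h0' : chartJac ψ (ψ.symm z) = 0 := h0.symm
  rw [inv_mul_cancel, chartJac_one hψ, h0', mul_zero] at h
  exact one_ne_zero h

theorem chartHaarDensity_pos (hψ : IsSmoothChartAtOne E ψ) {z : ι → ℝ} (hz : z ∈ ψ.target) :
    0 < chartHaarDensity ψ z :=
  inv_pos.2 (chartJac_pos hψ hz)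

theorem contDiffOn_chartHaarDensity (hψ : IsSmoothChartAtOne E ψ) :
    ContDiffOn ℝ ∞ (chartHaarDensity ψ) ψ.target := by
  intro ξ hξ
  have hξ1 : ψ.symm ξ * ψ.symm (ψ 1) ∈ ψ.source := by
    simpa [ψ.left_inv hψ.one_mem] using ψ.map_target hξ
  have h1 : ContDiffAt ℝ ∞ (fun ξ => fderiv ℝ (chartTransl ψ (ψ.symm ξ)) (ψ 1)) ξ :=
    (contDiffAt_uncurry_chartTransl hψ hξ (ψ.map_source hψ.one_mem) hξ1).fderiv
      contDiffAt_const (by simp)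
  have h2 := chartJac_pos hψ hξ
  refine ContDiffAt.contDiffWithinAt (ContDiffAt.inv ?_ h2.ne')
  refine ContDiffAt.comp ξ (contDiffAt_abs ?_)
    ((contDiff_continuousLinearMap_det (ι := ι)).contDiffAt.comp ξ h1)
  exact abs_pos.1 h2

variable [MeasurableSpace H] [BorelSpace H]

theorem measurableSet_target_inter_preimage_symm {A : Set H} (hA : MeasurableSet A) :
    MeasurableSet (ψ.target ∩ ψ.symm ⁻¹' A) := by
  have h : Measurable (fun z : ψ.target => ψ.symm z) :=
    (continuousOn_iff_continuous_domRestrict.1 ψ.continuousOn_symm).measurable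
  convert ψ.open_target.measurableSet.subtype_image (h hA) using 1
  ext z
  simp [and_comm]

theorem chartHaar_apply {A : Set H} (hA : MeasurableSet A) :
    chartHaar ψ A = ∫⁻ ξ in ψ.target ∩ ψ.symm ⁻¹' A, ENNReal.ofReal (chartHaarDensity ψ ξ) := by
  have h1 : AEMeasurable ψ.symm (volume.restrict ψ.target) :=
    ψ.continuousOn_symm.aemeasurable ψ.open_target.measurableSet
  rw [chartHaar, Measure.map_apply_of_aemeasurable
    (h1.mono_ac (withDensity_absolutelyContinuous _ _)) hA, withDensity_apply',
    Measure.restrict_restrict' ψ.open_target.measurableSet, inter_comm]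

/-- By `chartJac_mul`, translation by h has Jacobian J(hz)/J(z), which turns the density 1/J(hz)
into 1/J(z) under change of variables. Both sets must lie in the chart domain for this to make
sense. -/
theorem chartHaar_preimage_mul_left (hψ : IsSmoothChartAtOne E ψ) (h : H) {A : Set H}
    (hA : MeasurableSet A) (hAO : A ⊆ ψ.source) (hAO' : (h * ·) ⁻¹' A ⊆ ψ.source) :
    chartHaar ψ ((h * ·) ⁻¹' A) = chartHaar ψ A := by
  have : IsTopologicalGroup H := topologicalGroup_of_lieGroup 𝓘(ℝ, E) ∞
  have hA' : MeasurableSet ((h * ·) ⁻¹' A) := (continuous_const_mul h).measurable hA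
  rw [chartHaar_apply hA', chartHaar_apply hA]
  set S := ψ.target ∩ ψ.symm ⁻¹' ((h * ·) ⁻¹' A) with hS
  have hSm : MeasurableSet S := measurableSet_target_inter_preimage_symm hA'
  have himg : ψ.target ∩ ψ.symm ⁻¹' A = chartTransl ψ h '' S := by
    ext ξ
    constructor
    · rintro ⟨hξ, hξA⟩
      have hm : h⁻¹ * ψ.symm ξ ∈ ψ.source := hAO' (by simpa using hξA)
      refine ⟨ψ (h⁻¹ * ψ.symm ξ), ⟨ψ.map_source hm, ?_⟩, ?_⟩
      · simpa [ψ.left_inv hm] using hξA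
      · simp [chartTransl, ψ.left_inv hm, ψ.right_inv hξ]
    · rintro ⟨z, ⟨hz, hzA⟩, rfl⟩
      have hm : h * ψ.symm z ∈ ψ.source := hAO hzA
      refine ⟨ψ.map_source hm, ?_⟩
      simpa [chartTransl, ψ.left_inv hm] using hzA
  have hinj : InjOn (chartTransl ψ h) S := by
    rintro z ⟨hz, hzA⟩ w ⟨hw, hwA⟩ hzw
    have h1 := ψ.injOn (hAO hzA) (hAO hwA) hzw
    exact ψ.symm.injOn hz hw (mul_left_cancel h1)
  have hder : ∀ z ∈ S, HasFDerivWithinAt (chartTransl ψ h) (fderiv ℝ (chartTransl ψ h) z) S z :=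
    fun z hz => ((contDiffAt_chartTransl hψ hz.1 (hAO hz.2)).differentiableAt
      (by simp)).hasFDerivAt.hasFDerivWithinAt
  rw [himg, lintegral_image_eq_lintegral_abs_det_fderiv_mul volume hSm hder hinj]
  refine setLIntegral_congr_fun hSm fun z hz => ?_
  have hm : h * ψ.symm z ∈ ψ.source := hAO hz.2
  have hJ := chartJac_mul hψ hz.1 hm
  have hp := chartJac_pos hψ hz.1
  have hp' : 0 < chartJac ψ (h * ψ.symm z) := by
    have := chartJac_pos hψ (ψ.map_source hm)
    rwa [ψ.left_inv hm] at this
  have hd : |(fderiv ℝ (chartTransl ψ h) z).det| ≠ 0 := fun h0 => by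
    rw [h0, zero_mul] at hJ; exact hp'.ne' hJ
  rw [← ENNReal.ofReal_mul (abs_nonneg _)]
  congr 1
  rw [chartHaarDensity, chartHaarDensity, chartTransl, ψ.left_inv hm, hJ]
  field_simp

/-- Left translates of the domain of `ψ`, cut down to be disjoint. -/
noncomputable def translateCover [SecondCountableTopology H]
    (ψ : OpenPartialHomeomorph H (ι → ℝ)) : ℕ → Set H :=
  disjointed fun i => ((TopologicalSpace.denseSeq H i)⁻¹ * ·) ⁻¹' ψ.source

/-- The left invariant measure on `H` that extends `chartHaar ψ`. -/
noncomputable def globalChartHaar [SecondCountableTopology H]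
    (ψ : OpenPartialHomeomorph H (ι → ℝ)) : Measure H :=
  Measure.sum fun i => ((chartHaar ψ).map (TopologicalSpace.denseSeq H i * ·)).restrict
    (translateCover ψ i)

variable [SecondCountableTopology H]

theorem preimage_translateCover_subset (i : ℕ) :
    (TopologicalSpace.denseSeq H i * ·) ⁻¹' translateCover ψ i ⊆ ψ.source := by
  intro x hx
  have h := disjointed_subset _ i (show TopologicalSpace.denseSeq H i * x ∈ translateCover ψ i from hx)
  simpa using h

section Group

variable [IsTopologicalGroup H]

theorem measurableSet_translateCover (i : ℕ) : MeasurableSet (translateCover ψ i) :=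
  MeasurableSet.disjointed
    (fun _ => (continuous_const_mul _).measurable ψ.open_source.measurableSet) i

/-- A point x lies in dᵢ𝒪 exactly when dᵢ lies in the nonempty open set x𝒪⁻¹, which a dense sequence
meets. -/
theorem iUnion_translateCover (h1 : (1 : H) ∈ ψ.source) : ⋃ i, translateCover ψ i = univ := by
  rw [translateCover, iUnion_disjointed, eq_univ_iff_forall]
  intro x
  have hopen : IsOpen ((fun y : H => y⁻¹ * x) ⁻¹' ψ.source) :=
    ψ.open_source.preimage (by fun_prop)
  obtain ⟨i, hi⟩ := (TopologicalSpace.denseRange_denseSeq H).exists_mem_open hopen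
    ⟨x, by simpa using h1⟩
  exact mem_iUnion.2 ⟨i, hi⟩

theorem measure_eq_tsum_translateCover (h1 : (1 : H) ∈ ψ.source) (m : Measure H) {A : Set H}
    (hA : MeasurableSet A) : m A = ∑' i, m (A ∩ translateCover ψ i) := by
  have hdis : Pairwise (Function.onFun Disjoint (translateCover ψ)) := disjoint_disjointed _
  rw [← measure_iUnion (fun i j hij => (hdis hij).mono inter_subset_right inter_subset_right)
    (fun i => hA.inter (measurableSet_translateCover i)), ← inter_iUnion,
    iUnion_translateCover h1, inter_univ]

theorem globalChartHaar_apply {A : Set H} (hA : MeasurableSet A) :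
    globalChartHaar ψ A = ∑' i, chartHaar ψ
      ((TopologicalSpace.denseSeq H i * ·) ⁻¹' (A ∩ translateCover ψ i)) := by
  rw [globalChartHaar, Measure.sum_apply _ hA]
  refine tsum_congr fun i => ?_
  rw [Measure.restrict_apply hA, Measure.map_apply (continuous_const_mul _).measurable
    (hA.inter (measurableSet_translateCover i))]

end Group

theorem globalChartHaar_eq_chartHaar (hψ : IsSmoothChartAtOne E ψ) {A : Set H}
    (hA : MeasurableSet A) (hAO : A ⊆ ψ.source) : globalChartHaar ψ A = chartHaar ψ A := by
  have : IsTopologicalGroup H := topologicalGroup_of_lieGroup 𝓘(ℝ, E) ∞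
  rw [globalChartHaar_apply hA, measure_eq_tsum_translateCover hψ.one_mem _ hA]
  refine tsum_congr fun i => chartHaar_preimage_mul_left hψ _
    (hA.inter (measurableSet_translateCover i)) (inter_subset_left.trans hAO) ?_
  exact (preimage_mono inter_subset_right).trans (preimage_translateCover_subset i)

/-- Cut the set by the cover both before and after translation by g. Each double piece, moved back
into the chart by dᵢ⁻¹ or by dⱼ⁻¹, gives two sets that are translates of each other within the chart
domain, so local invariance applies; then the two sums are exchanged. -/
theorem isMulLeftInvariant_globalChartHaar (hψ : IsSmoothChartAtOne E ψ) :
    (globalChartHaar ψ).IsMulLeftInvariant := by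
  have : IsTopologicalGroup H := topologicalGroup_of_lieGroup 𝓘(ℝ, E) ∞
  refine ⟨fun g => Measure.ext fun A hA => ?_⟩
  have hmul (k : H) : Measurable (k * · : H → H) := (continuous_const_mul k).measurable
  have hc := measurableSet_translateCover (ψ := ψ)
  rw [Measure.map_apply (hmul g) hA, globalChartHaar_apply (hmul g hA), globalChartHaar_apply hA]
  set d := TopologicalSpace.denseSeq H
  calc ∑' i, chartHaar ψ ((d i * ·) ⁻¹' ((g * ·) ⁻¹' A ∩ translateCover ψ i))
      = ∑' i, ∑' j, chartHaar ψ
          ((d i * ·) ⁻¹' ((g * ·) ⁻¹' (A ∩ translateCover ψ j) ∩ translateCover ψ i)) := by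
        refine tsum_congr fun i => ?_
        have h := measure_eq_tsum_translateCover hψ.one_mem
          ((chartHaar ψ).map (fun x => g * (d i * x)))
          (hA.inter (hmul g⁻¹ (hc i)))
        have hm : Measurable (fun x => g * (d i * x)) := (hmul g).comp (hmul (d i))
        rw [Measure.map_apply hm (hA.inter (hmul g⁻¹ (hc i)))] at h
        convert h using 2
        · ext x; simp
        · funext j
          rw [Measure.map_apply hm ((hA.inter (hmul g⁻¹ (hc i))).inter (hc j))]
          congr 1
          ext x; simp; tauto
    _ = ∑' i, ∑' j, chartHaar ψ
          ((d j * ·) ⁻¹' ((A ∩ translateCover ψ j) ∩ (g⁻¹ * ·) ⁻¹' translateCover ψ i)) := by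
        refine tsum_congr fun i => tsum_congr fun j => ?_
        set B := (d j * ·) ⁻¹' ((A ∩ translateCover ψ j) ∩ (g⁻¹ * ·) ⁻¹' translateCover ψ i) with hB
        have hpre : (d i * ·) ⁻¹' ((g * ·) ⁻¹' (A ∩ translateCover ψ j) ∩ translateCover ψ i)
            = ((d j)⁻¹ * g * d i * ·) ⁻¹' B := by
          ext x; simp [hB, mul_assoc]
        rw [hpre]
        refine chartHaar_preimage_mul_left hψ _ ?_ ?_ ?_
        · exact hmul _ ((hA.inter (hc j)).inter (hmul _ (hc i)))
        · exact (preimage_mono (inter_subset_left.trans inter_subset_right)).trans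
            (preimage_translateCover_subset j)
        · rw [← hpre]
          exact (preimage_mono inter_subset_right).trans (preimage_translateCover_subset i)
    _ = ∑' j, ∑' i, chartHaar ψ
          ((d j * ·) ⁻¹' ((A ∩ translateCover ψ j) ∩ (g⁻¹ * ·) ⁻¹' translateCover ψ i)) :=
        ENNReal.tsum_comm
    _ = ∑' j, chartHaar ψ ((d j * ·) ⁻¹' (A ∩ translateCover ψ j)) := by
        refine tsum_congr fun j => ?_
        have hAj := hA.inter (hc j)
        have h := measure_eq_tsum_translateCover hψ.one_mem
          ((chartHaar ψ).map (fun x => g⁻¹ * (d j * x))) (A := (g * ·) ⁻¹' (A ∩ translateCover ψ j))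
          (hmul g hAj)
        have hm : Measurable (fun x => g⁻¹ * (d j * x)) := (hmul g⁻¹).comp (hmul (d j))
        rw [Measure.map_apply hm (hmul g hAj)] at h
        convert h.symm using 2
        · funext i
          rw [Measure.map_apply hm ((hmul g hAj).inter (hc i))]
          congr 1
          ext x; simp
        · ext x; simp

/-- A compact neighbourhood of 1 inside the chart has finite measure because the density is
continuous; invariance moves it to every point. -/
theorem isLocallyFiniteMeasure_globalChartHaar [LocallyCompactSpace H] [T2Space H]
    (hψ : IsSmoothChartAtOne E ψ) : IsLocallyFiniteMeasure (globalChartHaar ψ) := by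
  have : IsTopologicalGroup H := topologicalGroup_of_lieGroup 𝓘(ℝ, E) ∞
  have := isMulLeftInvariant_globalChartHaar hψ
  obtain ⟨K, hKn, hKO, hK⟩ := local_compact_nhds (ψ.open_source.mem_nhds hψ.one_mem)
  have hKm : MeasurableSet K := hK.isClosed.measurableSet
  have hfin : globalChartHaar ψ K < ⊤ := by
    rw [globalChartHaar_eq_chartHaar hψ hKm hKO, chartHaar_apply hKm]
    have himg : ψ.target ∩ ψ.symm ⁻¹' K = ψ '' K := by
      exact (ψ.image_eq_target_inter_inv_preimage hKO).symm
    have hcomp : IsCompact (ψ '' K) := hK.image_of_continuousOn (ψ.continuousOn.mono hKO)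
    rw [himg]
    have hint : IntegrableOn (chartHaarDensity ψ) (ψ '' K) volume :=
      ((contDiffOn_chartHaarDensity hψ).continuousOn.mono
        (by rw [← himg]; exact inter_subset_left)).integrableOn_compact hcomp
    exact hint.lintegral_lt_top
  refine ⟨fun x => ⟨(x⁻¹ * ·) ⁻¹' K, ?_, ?_⟩⟩
  · exact (continuous_const_mul x⁻¹).continuousAt.preimage_mem_nhds (by simpa using hKn)
  · rwa [measure_preimage_mul]

/-- A Haar measure has a smooth positive density in a smooth chart. -/
theorem exists_contDiffOn_density_haar [LocallyCompactSpace H] [T2Space H]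
    (hψ : IsSmoothChartAtOne E ψ) (μ : Measure H) [μ.IsHaarMeasure] :
    ∃ W : (ι → ℝ) → ℝ, ContDiffOn ℝ ∞ W ψ.target ∧ (∀ ξ ∈ ψ.target, 0 < W ξ) ∧
      (μ.restrict ψ.source).map ψ =
        (volume.restrict ψ.target).withDensity (fun ξ => ENNReal.ofReal (W ξ)) := by
  have : IsTopologicalGroup H := topologicalGroup_of_lieGroup 𝓘(ℝ, E) ∞
  have := isMulLeftInvariant_globalChartHaar hψ
  have := isLocallyFiniteMeasure_globalChartHaar hψ
  have hsm := Measure.isMulLeftInvariant_eq_smul (globalChartHaar ψ) μ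
  set c := Measure.haarScalarFactor (globalChartHaar ψ) μ
  have hO := ψ.open_source.measurableSet
  -- With c = 0 the chart domain would have measure zero, although the density is positive on the
  -- nonempty open target.
  have hc : c ≠ 0 := by
    intro h0
    rw [h0, zero_smul] at hsm
    have h1 := globalChartHaar_eq_chartHaar hψ hO subset_rfl
    rw [hsm, chartHaar_apply hO] at h1
    have h2 : ψ.target ∩ ψ.symm ⁻¹' ψ.source = ψ.target :=
      inter_eq_left.2 fun z hz => ψ.map_target hz
    rw [h2, Measure.coe_zero, Pi.zero_apply, eq_comm, lintegral_eq_zero_iff'] at h1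
    · have h3 : volume ψ.target = 0 := by
        have h4 : ∀ᵐ z ∂(volume.restrict ψ.target), False := by
          filter_upwards [h1, ae_restrict_mem ψ.open_target.measurableSet] with z hz hzt
          exact (ENNReal.ofReal_pos.2 (chartHaarDensity_pos hψ hzt)).ne' hz
        simpa using h4
      exact (ψ.open_target.measure_pos volume ⟨_, ψ.map_source hψ.one_mem⟩).ne' h3
    · exact ((contDiffOn_chartHaarDensity hψ).continuousOn.aemeasurable
        ψ.open_target.measurableSet).ennreal_ofReal
  refine ⟨fun ξ => (c : ℝ)⁻¹ * chartHaarDensity ψ ξ,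
    contDiffOn_const.mul (contDiffOn_chartHaarDensity hψ), fun ξ hξ => ?_, ?_⟩
  · have : 0 < (c : ℝ) := by positivity
    exact mul_pos (inv_pos.2 this) (chartHaarDensity_pos hψ hξ)
  · ext A hA
    have hcont : ContinuousOn ψ ψ.source := ψ.continuousOn
    have hOA : MeasurableSet (ψ.source ∩ ψ ⁻¹' A) := by
      have h : Measurable (fun z : ψ.source => ψ z) :=
        (continuousOn_iff_continuous_domRestrict.1 hcont).measurable
      convert hO.subtype_image (h hA) using 1
      ext z
      simp [and_comm]
    rw [Measure.map_apply_of_aemeasurable (hcont.aemeasurable hO) hA, Measure.restrict_apply' hO,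
      withDensity_apply', Measure.restrict_restrict' ψ.open_target.measurableSet, inter_comm]
    have h1 := globalChartHaar_eq_chartHaar hψ hOA inter_subset_left
    have h2 : ψ.target ∩ ψ.symm ⁻¹' (ψ.source ∩ ψ ⁻¹' A) = A ∩ ψ.target := by
      ext z
      constructor
      · rintro ⟨hz, -, hzA⟩
        exact ⟨by simpa [ψ.right_inv hz] using hzA, hz⟩
      · rintro ⟨hzA, hz⟩
        exact ⟨hz, ψ.map_target hz, by simpa [ψ.right_inv hz] using hzA⟩
    rw [hsm, chartHaar_apply hOA, h2] at h1
    simp_rw [ENNReal.ofReal_mul (inv_nonneg.2 c.coe_nonneg)]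
    rw [lintegral_const_mul' _ _ ENNReal.ofReal_ne_top, ← h1]
    rw [Measure.smul_apply, ENNReal.ofReal_inv_of_pos (by positivity), ENNReal.ofReal_coe_nnreal,
      ENNReal.smul_def, smul_eq_mul, ← mul_assoc, ENNReal.inv_mul_cancel (by simpa) (by simp),
      one_mul]

end ChartHaar

/-! ### Countability of connected Lie groups -/

open scoped Pointwise in
/-- A connected locally compact group is `σ`-compact. -/
theorem sigmaCompactSpace_of_connected {H : Type*} [TopologicalSpace H] [Group H]
    [IsTopologicalGroup H] [LocallyCompactSpace H] [ConnectedSpace H] : SigmaCompactSpace H := by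
  obtain ⟨L, hLc, hL1⟩ := exists_compact_mem_nhds (1 : H)
  set K := L ∪ L⁻¹ with hK
  have hKc : IsCompact K := hLc.union hLc.inv
  have hKinv : K⁻¹ = K := by rw [hK, union_inv, inv_inv, union_comm]
  have hpow : ∀ n : ℕ, IsCompact (K ^ n) := by
    intro n
    induction n with
    | zero => rw [pow_zero]; exact isCompact_singleton
    | succ n ih => rw [pow_succ]; exact ih.mul hKc
  -- The powers of a compact symmetric neighbourhood of 1 form an open, hence closed, subgroup;
  -- connectedness makes it all of H.
  let S : Subgroup H :=
    { carrier := ⋃ n : ℕ, K ^ n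
      one_mem' := mem_iUnion.2 ⟨0, by simp⟩
      mul_mem' := by
        intro a b ha hb
        obtain ⟨m, hm⟩ := mem_iUnion.1 ha
        obtain ⟨n, hn⟩ := mem_iUnion.1 hb
        exact mem_iUnion.2 ⟨m + n, by rw [pow_add]; exact mul_mem_mul hm hn⟩
      inv_mem' := by
        intro a ha
        obtain ⟨m, hm⟩ := mem_iUnion.1 ha
        refine mem_iUnion.2 ⟨m, ?_⟩
        rw [← hKinv, inv_pow]
        exact inv_mem_inv.2 hm }
  have hS : (S : Set H) ∈ nhds (1 : H) := by
    refine Filter.mem_of_superset hL1 fun x hx => mem_iUnion.2 ⟨1, ?_⟩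
    rw [pow_one]; exact Or.inl hx
  have hopen := S.isOpen_of_mem_nhds hS
  have huniv : (S : Set H) = univ :=
    IsClopen.eq_univ ⟨S.isClosed_of_isOpen hopen, hopen⟩ ⟨1, S.one_mem⟩
  exact ⟨⟨fun n => K ^ n, hpow, huniv⟩⟩

theorem secondCountableTopology_of_connected_lieGroup {E H : Type*} [NormedAddCommGroup E]
    [NormedSpace ℝ E] [FiniteDimensional ℝ E] [TopologicalSpace H] [ChartedSpace E H] [Group H]
    [LieGroup 𝓘(ℝ, E) ∞ H] [ConnectedSpace H] : SecondCountableTopology H := by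
  have : IsTopologicalGroup H := topologicalGroup_of_lieGroup 𝓘(ℝ, E) ∞
  have : LocallyCompactSpace H := Manifold.locallyCompact_of_finiteDimensional 𝓘(ℝ, E)
  have := sigmaCompactSpace_of_connected (H := H)
  have : ProperSpace E := FiniteDimensional.proper ℝ E
  exact ChartedSpace.secondCountable_of_sigmaCompact E H

/-- Densities of one measure agree almost everywhere, and continuity upgrades this to equality on an
open set. Hence the arbitrary choice in `densityW` is harmless. -/
theorem IsContinuousDensity.eqOn {ι : Type*} [Fintype ι] {U : Set (ι → ℝ)} (hU : IsOpen U)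
    {ν : Measure (ι → ℝ)} {W₁ W₂ : (ι → ℝ) → ℝ} (h₁ : IsContinuousDensity U ν W₁)
    (h₂ : IsContinuousDensity U ν W₂) : EqOn W₁ W₂ U := by
  obtain ⟨hc₁, hp₁, hν₁⟩ := h₁
  obtain ⟨hc₂, hp₂, hν₂⟩ := h₂
  have h := (withDensity_eq_iff_of_sigmaFinite (hc₁.aemeasurable hU.measurableSet).ennreal_ofReal
    (hc₂.aemeasurable hU.measurableSet).ennreal_ofReal).1 (hν₁.symm.trans hν₂)
  refine Measure.eqOn_open_of_ae_eq (μ := volume) ?_ hU hc₁ hc₂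
  filter_upwards [h, ae_restrict_mem hU.measurableSet] with ξ hξ hξU
  exact (ENNReal.ofReal_eq_ofReal_iff (hp₁ ξ hξU).le (hp₂ ξ hξU).le).1 hξ

/-! ### Parseval in the chart and summation over translates -/

section Parseval

variable {ι : Type*} [Fintype ι] {H : Type*} [TopologicalSpace H] [MeasurableSpace H]
  [BorelSpace H] {ψ : OpenPartialHomeomorph H (ι → ℝ)} {μ : Measure H} {W : (ι → ℝ) → ℝ}

theorem restrict_source_eq_map_symm (hμ : (μ.restrict ψ.source).map ψ =
      (volume.restrict ψ.target).withDensity (fun ξ => ENNReal.ofReal (W ξ))) :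
    μ.restrict ψ.source =
      ((volume.restrict ψ.target).withDensity (fun ξ => ENNReal.ofReal (W ξ))).map ψ.symm := by
  have hO := ψ.open_source.measurableSet
  have h1 : AEMeasurable ψ.symm ((μ.restrict ψ.source).map ψ) := by
    rw [hμ]
    exact (ψ.continuousOn_symm.aemeasurable ψ.open_target.measurableSet).mono_ac
      (withDensity_absolutelyContinuous _ _)
  rw [← hμ, AEMeasurable.map_map_of_aemeasurable h1 (ψ.continuousOn.aemeasurable hO)]
  conv_lhs => rw [← Measure.map_id (μ := μ.restrict ψ.source)]
  refine Measure.map_congr ?_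
  filter_upwards [ae_restrict_mem hO] with h hh
  simp [ψ.left_inv hh]

variable {F : Type*} [NormedAddCommGroup F] [NormedSpace ℝ F]

theorem setIntegral_source_eq (hW : ContinuousOn W ψ.target) (hWpos : ∀ ξ ∈ ψ.target, 0 < W ξ)
    (hμ : (μ.restrict ψ.source).map ψ =
      (volume.restrict ψ.target).withDensity (fun ξ => ENNReal.ofReal (W ξ)))
    {f : H → F} (hf : AEStronglyMeasurable f (μ.restrict ψ.source)) :
    AEStronglyMeasurable (f ∘ ψ.symm) (volume.restrict ψ.target) ∧
    (IntegrableOn f ψ.source μ ↔ IntegrableOn (fun ξ => W ξ • f (ψ.symm ξ)) ψ.target volume) ∧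
    ∫ h in ψ.source, f h ∂μ = ∫ ξ in ψ.target, W ξ • f (ψ.symm ξ) := by
  have hT := ψ.open_target.measurableSet
  have hWm : AEMeasurable (fun ξ => ENNReal.ofReal (W ξ)) (volume.restrict ψ.target) :=
    (hW.aemeasurable hT).ennreal_ofReal
  have hψ : AEMeasurable ψ.symm
      ((volume.restrict ψ.target).withDensity (fun ξ => ENNReal.ofReal (W ξ))) :=
    (ψ.continuousOn_symm.aemeasurable hT).mono_ac (withDensity_absolutelyContinuous _ _)
  have hlt : ∀ᵐ ξ ∂(volume.restrict ψ.target), ENNReal.ofReal (W ξ) < ⊤ :=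
    Filter.Eventually.of_forall fun _ => ENNReal.ofReal_lt_top
  have heq : (fun ξ => (ENNReal.ofReal (W ξ)).toReal • f (ψ.symm ξ))
      =ᵐ[volume.restrict ψ.target] fun ξ => W ξ • f (ψ.symm ξ) := by
    filter_upwards [ae_restrict_mem hT] with ξ hξ
    rw [ENNReal.toReal_ofReal (hWpos ξ hξ).le]
  have hac : volume.restrict ψ.target ≪
      (volume.restrict ψ.target).withDensity (fun ξ => ENNReal.ofReal (W ξ)) := by
    refine withDensity_absolutelyContinuous' hWm ?_
    filter_upwards [ae_restrict_mem hT] with ξ hξ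
    exact (ENNReal.ofReal_pos.2 (hWpos ξ hξ)).ne'
  rw [restrict_source_eq_map_symm hμ] at hf
  refine ⟨(hf.comp_aemeasurable hψ).mono_ac hac, ?_, ?_⟩
  · rw [IntegrableOn, restrict_source_eq_map_symm hμ, integrable_map_measure hf hψ,
      integrable_withDensity_iff_integrable_smul₀' hWm hlt]
    exact integrable_congr heq
  · rw [restrict_source_eq_map_symm hμ, integral_map hψ hf,
      integral_withDensity_eq_integral_toReal_smul₀ hWm hlt]
    exact integral_congr_ae heq

/-- The Parseval identity for an orthonormal basis of `L²(C)`, transported by the chart `ψ` with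
`ψ.target ⊆ C` to functions on `H`. -/
theorem hasSum_sq_norm_integral_chart (hW : ContinuousOn W ψ.target)
    (hWpos : ∀ ξ ∈ ψ.target, 0 < W ξ)
    (hμ : (μ.restrict ψ.source).map ψ =
      (volume.restrict ψ.target).withDensity (fun ξ => ENNReal.ofReal (W ξ)))
    {C : Set (ι → ℝ)} (hTC : ψ.target ⊆ C) {Γ : Type*}
    (b : HilbertBasis Γ ℂ (Lp ℂ 2 (volume.restrict C))) {e : Γ → (ι → ℝ) → ℂ}
    (he : ∀ κ, Continuous (e κ)) (hb : ∀ κ, b κ =ᵐ[volume.restrict C] e κ)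
    {g s : H → ℂ} (hg : AEStronglyMeasurable g μ) (hs : Continuous s)
    (hsupp : ∀ h ∉ ψ.source, s h = 0) (hgs : Integrable (fun h => ‖g h‖ ^ 2 * ‖s h‖ ^ 2) μ) :
    HasSum (fun κ => ‖∫ h, starRingEnd ℂ (g h) *
        (e κ (ψ h) * s h * ((W (ψ h) ^ (-(1 / 2) : ℝ) : ℝ) : ℂ)) ∂μ‖ ^ 2)
      (∫ h, ‖g h‖ ^ 2 * ‖s h‖ ^ 2 ∂μ) := by
  have hT := ψ.open_target.measurableSet
  have hO := ψ.open_source.measurableSet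
  have hgO : AEStronglyMeasurable g (μ.restrict ψ.source) := hg.restrict
  have hsO : AEStronglyMeasurable s (μ.restrict ψ.source) := hs.aestronglyMeasurable
  have hψO : ∀ {f : (ι → ℝ) → ℂ}, ContinuousOn f ψ.target →
      AEStronglyMeasurable (fun h => f (ψ h)) (μ.restrict ψ.source) := fun {f} hf =>
    (hf.comp ψ.continuousOn fun h hh => ψ.map_source hh).aestronglyMeasurable hO
  have hWc : ∀ r : ℝ, ContinuousOn (fun ξ => ((W ξ ^ r : ℝ) : ℂ)) ψ.target := fun r =>
    Complex.continuous_ofReal.comp_continuousOn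
      (hW.rpow_const fun ξ hξ => Or.inl (hWpos ξ hξ).ne')
  -- The exponent 1/2 serves twice: |Φ|² carries exactly the factor W of dμ = W dξ, and W · W^{-1/2}
  -- = W^{1/2} makes the coefficients of Φ the required integrals. Extension by zero allows C to be
  -- larger than the image of the chart.
  set Φ : (ι → ℝ) → ℂ := ψ.target.indicator fun ξ =>
    g (ψ.symm ξ) * starRingEnd ℂ (s (ψ.symm ξ)) * ((W ξ ^ (1 / 2 : ℝ) : ℝ) : ℂ) with hΦ
  have hΦm : AEStronglyMeasurable Φ (volume.restrict C) := by
    rw [hΦ, aestronglyMeasurable_indicator_iff hT, Measure.restrict_restrict hT,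
      inter_eq_left.2 hTC]
    refine AEStronglyMeasurable.mul (AEStronglyMeasurable.mul ?_ ?_) ?_
    · exact (setIntegral_source_eq hW hWpos hμ hgO).1
    · exact Complex.continuous_conj.comp_aestronglyMeasurable
        (setIntegral_source_eq hW hWpos hμ hsO).1
    · exact (hWc _).aestronglyMeasurable hT
  have hsq := setIntegral_source_eq hW hWpos hμ hgs.aestronglyMeasurable.restrict
  have hΦsq : (fun ξ => ‖Φ ξ‖ ^ 2) = ψ.target.indicator
      fun ξ => W ξ • (‖g (ψ.symm ξ)‖ ^ 2 * ‖s (ψ.symm ξ)‖ ^ 2) := by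
    funext ξ
    by_cases hξ : ξ ∈ ψ.target
    · rw [hΦ, indicator_of_mem hξ, indicator_of_mem hξ]
      have h0 := hWpos ξ hξ
      have h1 : ‖((W ξ ^ (1 / 2 : ℝ) : ℝ) : ℂ)‖ ^ 2 = W ξ := by
        rw [Complex.norm_real, Real.norm_of_nonneg (by positivity), ← Real.rpow_natCast,
          ← Real.rpow_mul h0.le]
        norm_num
      rw [norm_mul, norm_mul, mul_pow, mul_pow, h1, RCLike.norm_conj, smul_eq_mul]
      ring
    · rw [hΦ, indicator_of_notMem hξ, indicator_of_notMem hξ]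
      simp
  have hΦL : MemLp Φ 2 (volume.restrict C) := by
    rw [memLp_two_iff_integrable_sq_norm hΦm, hΦsq, integrable_indicator_iff hT, IntegrableOn,
      Measure.restrict_restrict hT, inter_eq_left.2 hTC]
    exact hsq.2.1.1 hgs.integrableOn
  have hnorm : ‖hΦL.toLp Φ‖ ^ 2 = ∫ h, ‖g h‖ ^ 2 * ‖s h‖ ^ 2 ∂μ := by
    have h1 : ∫ h, ‖g h‖ ^ 2 * ‖s h‖ ^ 2 ∂μ = ∫ h in ψ.source, ‖g h‖ ^ 2 * ‖s h‖ ^ 2 ∂μ :=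
      (setIntegral_eq_integral_of_forall_compl_eq_zero fun h hh => by simp [hsupp h hh]).symm
    have h2 : ∫ ξ in C, ‖Φ ξ‖ ^ 2 = ∫ h in ψ.source, ‖g h‖ ^ 2 * ‖s h‖ ^ 2 ∂μ := by
      rw [hsq.2.2, hΦsq, integral_indicator hT, Measure.restrict_restrict hT,
        inter_eq_left.2 hTC]
    rw [h1, ← h2, ← inner_self_eq_norm_sq (𝕜 := ℂ), L2.inner_def]
    have h3 : ∫ ξ in C, inner ℂ (hΦL.toLp Φ ξ) (hΦL.toLp Φ ξ) =
        ((∫ ξ in C, ‖Φ ξ‖ ^ 2 : ℝ) : ℂ) := by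
      rw [← integral_complex_ofReal]
      refine integral_congr_ae ?_
      filter_upwards [hΦL.coeFn_toLp] with ξ hξ
      rw [hξ, inner_self_eq_norm_sq_to_K]
      simp
    rw [h3]
    simp
  have hinner : ∀ κ, inner ℂ (hΦL.toLp Φ) (b κ) = ∫ h, starRingEnd ℂ (g h) *
        (e κ (ψ h) * s h * ((W (ψ h) ^ (-(1 / 2) : ℝ) : ℝ) : ℂ)) ∂μ := by
    intro κ
    set f : H → ℂ := fun h => starRingEnd ℂ (g h) *
        (e κ (ψ h) * s h * ((W (ψ h) ^ (-(1 / 2) : ℝ) : ℝ) : ℂ)) with hf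
    have hfm : AEStronglyMeasurable f (μ.restrict ψ.source) :=
      (Complex.continuous_conj.comp_aestronglyMeasurable hgO).mul
        (((hψO (he κ).continuousOn).mul hsO).mul (hψO (hWc _)))
    have h1 : ∫ h, f h ∂μ = ∫ h in ψ.source, f h ∂μ :=
      (setIntegral_eq_integral_of_forall_compl_eq_zero fun h hh => by
        simp [hf, hsupp h hh]).symm
    rw [h1, (setIntegral_source_eq hW hWpos hμ hfm).2.2, L2.inner_def]
    have h2 : ∫ ξ in ψ.target, W ξ • f (ψ.symm ξ) =
        ∫ ξ in C, ψ.target.indicator (fun ξ => W ξ • f (ψ.symm ξ)) ξ := by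
      rw [integral_indicator hT, Measure.restrict_restrict hT, inter_eq_left.2 hTC]
    rw [h2]
    refine integral_congr_ae ?_
    filter_upwards [hΦL.coeFn_toLp, hb κ] with ξ hξ hξb
    rw [hξ, hξb, RCLike.inner_apply]
    by_cases hmem : ξ ∈ ψ.target
    · rw [hΦ, indicator_of_mem hmem, indicator_of_mem hmem, hf]
      have h0 := hWpos ξ hmem
      have h3 : W ξ ^ (1 / 2 : ℝ) = W ξ * W ξ ^ (-(1 / 2) : ℝ) := by
        rw [← Real.rpow_one_add' h0.le (by norm_num)]
        norm_num
      simp only [ψ.right_inv hmem, map_mul, Complex.conj_conj, Complex.conj_ofReal, h3,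
        Complex.real_smul, Complex.ofReal_mul]
      ring
    · rw [hΦ, indicator_of_notMem hmem, indicator_of_notMem hmem]
      simp
  have hsum := b.hasSum_inner_mul_inner (hΦL.toLp Φ) (hΦL.toLp Φ)
  rw [← hnorm]
  have h1 := Complex.hasSum_re hsum
  convert h1 using 1
  · funext κ
    rw [← hinner, ← inner_conj_symm (b κ), RCLike.mul_conj]
    norm_cast
  · rw [inner_self_eq_norm_sq_to_K]
    norm_cast

end Parseval

/-- If `∑ |s (l h)|² = 1` for almost every `h`, then `∑ ∫ |g (l⁻¹ h)|² |s h|² = ∫ |g|²`. -/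
theorem hasSum_integral_translate {H : Type*} [Group H] [MeasurableSpace H] [MeasurableMul H]
    {μ : Measure H} [μ.IsMulLeftInvariant] {Γ : Set H} [Countable Γ] {g s : H → ℂ}
    (hs : Measurable s) (hg : MemLp g 2 μ)
    (hsum : ∀ᵐ h ∂μ, HasSum (fun l : Γ => ‖s ((l : H) * h)‖ ^ 2) 1) :
    (∀ l : Γ, Integrable (fun h => ‖g ((l : H)⁻¹ * h)‖ ^ 2 * ‖s h‖ ^ 2) μ) ∧
    HasSum (fun l : Γ => ∫ h, ‖g ((l : H)⁻¹ * h)‖ ^ 2 * ‖s h‖ ^ 2 ∂μ) (∫ h, ‖g h‖ ^ 2 ∂μ) := by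
  have hgi : Integrable (fun h => ‖g h‖ ^ 2) μ :=
    (memLp_two_iff_integrable_sq_norm hg.aestronglyMeasurable).1 hg
  have hms : ∀ l : Γ, Measurable fun h => ‖s ((l : H) * h)‖ ^ 2 := fun l =>
    (hs.comp (measurable_const_mul _)).norm.pow_const 2
  have hm : ∀ l : Γ, AEStronglyMeasurable (fun h => ‖g h‖ ^ 2 * ‖s ((l : H) * h)‖ ^ 2) μ :=
    fun l => hgi.aestronglyMeasurable.mul (hms l).aestronglyMeasurable
  -- Each term of a nonnegative series with sum 1 is at most 1, so |g|² dominates.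
  have hle : ∀ l : Γ, ∀ᵐ h ∂μ, ‖‖g h‖ ^ 2 * ‖s ((l : H) * h)‖ ^ 2‖ ≤ ‖g h‖ ^ 2 := by
    intro l
    filter_upwards [hsum] with h hh
    rw [Real.norm_of_nonneg (by positivity)]
    exact mul_le_of_le_one_right (by positivity) (le_hasSum hh l fun _ _ => by positivity)
  have hint : ∀ l : Γ, Integrable (fun h => ‖g h‖ ^ 2 * ‖s ((l : H) * h)‖ ^ 2) μ := fun l =>
    hgi.mono' (hm l) (hle l)
  have htr : ∀ l : Γ, (fun h => ‖g ((l : H)⁻¹ * h)‖ ^ 2 * ‖s h‖ ^ 2) =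
      fun h => (fun h => ‖g h‖ ^ 2 * ‖s ((l : H) * h)‖ ^ 2) ((l : H)⁻¹ * h) := by
    intro l; funext h; simp
  refine ⟨fun l => ?_, ?_⟩
  · rw [htr l]
    exact (hint l).comp_mul_left _
  · have hsm : ∀ᵐ h ∂μ, HasSum (fun l : Γ => ‖g h‖ ^ 2 * ‖s ((l : H) * h)‖ ^ 2) (‖g h‖ ^ 2) := by
      filter_upwards [hsum] with h hh
      simpa using hh.mul_left (‖g h‖ ^ 2)
    have h := hasSum_integral_of_dominated_convergence (μ := μ)
      (fun (l : Γ) h => ‖g h‖ ^ 2 * ‖s ((l : H) * h)‖ ^ 2) hm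
      (fun l => Filter.Eventually.of_forall fun h => by
        rw [Real.norm_of_nonneg (by positivity)])
      (hsm.mono fun h hh => hh.summable)
      (hgi.congr (hsm.mono fun h hh => hh.tsum_eq.symm)) hsm
    have hfun : (fun l : Γ => ∫ h, ‖g ((l : H)⁻¹ * h)‖ ^ 2 * ‖s h‖ ^ 2 ∂μ) =
        fun l : Γ => ∫ h, ‖g h‖ ^ 2 * ‖s ((l : H) * h)‖ ^ 2 ∂μ := by
      funext l
      rw [htr l]
      exact integral_mul_left_eq_self (fun h => ‖g h‖ ^ 2 * ‖s ((l : H) * h)‖ ^ 2) _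
    rw [hfun]
    exact h

/-- Nonnegativity turns iterated summability into unconditional summability over pairs. -/
theorem hasSum_prod_of_nonneg {α β : Type*} {f : α × β → ℝ} (hf : 0 ≤ f) {u : α → ℝ} {a : ℝ}
    (h₁ : ∀ x, HasSum (fun y => f (x, y)) (u x)) (h₂ : HasSum u a) : HasSum f a := by
  have hs : Summable f := (summable_prod_of_nonneg hf).2
    ⟨fun x => (h₁ x).summable, by simpa only [(h₁ _).tsum_eq] using h₂.summable⟩
  have h := hs.hasSum.prod_fiberwise h₁
  exact h.unique h₂ ▸ hs.hasSum

/-! ### The chart Θ_λ ∘ φ and the phase on 𝔭 -/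

section Chart

variable {G : Type*} [Group G] [TopologicalSpace G]
  {EN : Type*} [NormedAddCommGroup EN] [NormedSpace ℝ EN]
  {N : Subgroup G} [N.Normal] [ChartedSpace EN N] {H : Subgroup G}
  {n : ℕ} {X : Basis (Fin n) ℝ (LieAlg (E := EN) N)} {J : Finset (Fin n)}
  {lam : Dual ℝ (LieAlg (E := EN) N)}

/-- P is the identity on 𝔭, so β_λ(h) and P*β_λ(h) agree there. This is where log κ ∈ 𝔭 is needed:
the phase becomes a function of the chart coordinate. -/
theorem betaMap_eq_pairing_projBeta {Y : LieAlg (E := EN) N} (hY : Y ∈ pSpace X J) (h : H) :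
    betaMap lam h Y = pairing X J (projBeta X J lam h) Y := by
  obtain ⟨Z, rfl⟩ := hY
  have hZ : projJ X J Z = ∑ j : J, X.repr Z j • X j := by
    rw [projJ, Basis.constr_apply_fintype]
    simp only [smul_ite, smul_zero, Basis.equivFun_apply]
    rw [← Finset.sum_filter, Finset.filter_mem_eq_inter, Finset.univ_inter]
    exact (Finset.sum_coe_sort J fun k => X.repr Z k • X k).symm
  have hrepr : ∀ j : J, X.repr (projJ X J Z) j = X.repr Z j := by
    intro j
    rw [hZ]
    simp [Finsupp.single_apply]
  rw [pairing]
  simp only [hrepr]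
  rw [hZ, map_sum]
  refine Finset.sum_congr rfl fun j _ => ?_
  rw [map_smul, projBeta, LinearMap.dualMap_apply, projJ, Basis.constr_basis, if_pos j.2,
    smul_eq_mul, mul_comm]

variable {EH : Type*} [NormedAddCommGroup EH] [NormedSpace ℝ EH] [ChartedSpace EH H]
  {φ : OpenPartialHomeomorph H EH}

/-- The chart `Θ_lam ∘ φ` of `H`. -/
theorem IsAdaptedChart.exists_smoothChart (hφ : IsAdaptedChart X J lam φ) :
    ∃ ψ : OpenPartialHomeomorph H (J → ℝ), ψ.source = φ.source ∧
      ψ.target = thetaMap X J lam φ '' φ.target ∧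
      (∀ h ∈ φ.source, ψ h = thetaMap X J lam φ (φ h)) ∧ IsSmoothChartAtOne EH ψ := by
  obtain ⟨e, hes, heq, he, he'⟩ := hφ.diffeo
  refine ⟨φ.trans' e hes.symm, rfl, ?_, fun h hh => (heq (φ.map_source hh)).symm, hφ.one_mem,
    ?_, ?_⟩
  · rw [heq.image_eq]
    exact e.image_source_eq_target.symm.trans (congrArg _ hes)
  · refine ContMDiffOn.comp (t := e.source) he.contMDiffOn
      (contMDiffOn_of_mem_maximalAtlas hφ.mem_maximalAtlas) fun h hh => ?_
    rw [hes]; exact φ.map_source hh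
  · refine ContMDiffOn.comp (t := φ.target)
      (contMDiffOn_symm_of_mem_maximalAtlas hφ.mem_maximalAtlas) he'.contMDiffOn fun ξ hξ => ?_
    rw [← hes]; exact e.map_target hξ

theorem thetaMap_apply_chart {h : H} (hh : h ∈ φ.source) :
    thetaMap X J lam φ (φ h) = projBeta X J lam h := by
  rw [thetaMap, φ.left_inv hh]

end Chart
-- The Parseval frame
theorem mainTheorem9
    {EG EN EH : Type*}
    [NormedAddCommGroup EG] [NormedSpace ℝ EG] [FiniteDimensional ℝ EG]
    [NormedAddCommGroup EN] [NormedSpace ℝ EN] [FiniteDimensional ℝ EN]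
    [NormedAddCommGroup EH] [NormedSpace ℝ EH] [FiniteDimensional ℝ EH]
    -- the Lie group `G = N H` and its closed connected Lie subgroups `N` (normal) and `H`
    {G : Type*} [TopologicalSpace G] [T2Space G] [ChartedSpace EG G] [Group G]
    [LieGroup 𝓘(ℝ, EG) ∞ G]
    (N H : Subgroup G) [N.Normal]
    [ChartedSpace EN N] [LieGroup 𝓘(ℝ, EN) ∞ N]
    [ChartedSpace EH H] [LieGroup 𝓘(ℝ, EH) ∞ H]
    (hNclosed : IsClosed (N : Set G)) (hHclosed : IsClosed (H : Set G))
    (hNconn : IsConnected (N : Set G)) (hHconn : IsConnected (H : Set G))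
    (hNsmooth : ContMDiff 𝓘(ℝ, EN) 𝓘(ℝ, EG) ∞ (fun x : N => (x : G)))
    (hHsmooth : ContMDiff 𝓘(ℝ, EH) 𝓘(ℝ, EG) ∞ (fun z : H => (z : G)))
    (hNH : Subgroup.IsComplement' N H)
    (hNexp : IsExponentialSolvable EN N)
    -- left Haar measure on `H`
    [MeasurableSpace H] [BorelSpace H] (μ : Measure H) [μ.IsHaarMeasure]
    -- the linear functional `lam` defining the character of `N`
    (lam : Module.Dual ℝ (LieAlg (E := EN) N))
    (hlam : ∀ Y Z : LieAlg (E := EN) N, lam ⁅Y, Z⁆ = 0)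
    {n : ℕ} (X : Module.Basis (Fin n) ℝ (LieAlg (E := EN) N))
    (himm : IsImmersionAtOne (H := H) (EH := EH) X lam)
    -- the set `J` and the chart `(𝒪, φ)`
    (J : Finset (Fin n)) (φ : OpenPartialHomeomorph H EH) (hφ : IsAdaptedChart X J lam φ)
    -- the function `s` and the discrete set `Γ_H`
    (s : H → ℂ) (hs : Continuous s) (hsupp : tsupport s ⊆ φ.source)
    (ΓH : Set H) (hΓH : IsDiscrete ΓH)
    (hsum : ∀ᵐ h ∂μ, HasSum (fun l : ΓH => ‖s ((l : H) * h)‖ ^ 2) 1)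
    -- the compact set `C` and the discrete set `Γ_N`
    (C : Set (J → ℝ)) (hC : IsCompact C) (hCsub : thetaMap X J lam φ '' φ.target ⊆ C)
    (ΓN : Set N) (hΓN : IsDiscrete ΓN)
    (hΓNsub : ΓN ⊆ lieExp '' (pSpace X J : Set (LieAlg (E := EN) N)))
    (hONB : IsExponentialONB X J C ΓN) :
    Continuous (generator X J lam φ μ C s) ∧
    HasCompactSupport (generator X J lam φ μ C s) ∧
    (ContMDiff 𝓘(ℝ, EH) 𝓘(ℝ, ℂ) ∞ s →
      ContMDiff 𝓘(ℝ, EH) 𝓘(ℝ, ℂ) ∞ (generator X J lam φ μ C s)) ∧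
    ∃ v : ΓH × ΓN → Lp ℂ 2 μ,
      (∀ p : ΓH × ΓN, v p =ᵐ[μ]
        inducedRep hNH lam (((p.1 : H) : G)⁻¹ * ((p.2 : N) : G)) (generator X J lam φ μ C s)) ∧
      IsParsevalFrame v := by

  have hNbij : Function.Bijective (lieExp : LieAlg (E := EN) N → N) := hNexp.2
  have : ConnectedSpace H := isConnected_iff_connectedSpace.1 hHconn
  have : IsTopologicalGroup H := topologicalGroup_of_lieGroup 𝓘(ℝ, EH) ∞
  have : LocallyCompactSpace H := Manifold.locallyCompact_of_finiteDimensional 𝓘(ℝ, EH)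
  have : SecondCountableTopology H := secondCountableTopology_of_connected_lieGroup (E := EH)
  have : Countable ΓH :=
    ((HereditarilyLindelofSpace.isLindelof ΓH).countable_of_isDiscrete hΓH).to_subtype
  obtain ⟨ψ, hsrc, htgt, hψθ, hψ⟩ := hφ.exists_smoothChart
  obtain ⟨W, hWs, hWpos, hWμ⟩ := exists_contDiffOn_density_haar hψ μ
  set f := generator X J lam φ μ C s with hf
  have hweight : ∀ h ∈ φ.source, weight X J lam φ μ h = W (ψ h) := by
    have hW : IsContinuousDensity (thetaMap X J lam φ '' φ.target)
        ((μ.restrict φ.source).map (fun h => thetaMap X J lam φ (φ h))) W := by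
      rw [← htgt]
      refine ⟨hWs.continuousOn, hWpos, ?_⟩
      rw [← hWμ, hsrc]
      refine Measure.map_congr ?_
      filter_upwards [ae_restrict_mem φ.open_source.measurableSet] with h hh
      exact (hψθ h hh).symm
    intro h hh
    rw [weight, ← hψθ h hh]
    refine IsContinuousDensity.eqOn (htgt ▸ ψ.open_target) (Classical.epsilon_spec ⟨W, hW⟩) hW ?_
    rw [← htgt]
    exact ψ.map_source (hsrc ▸ hh)
  have hs0 : ∀ h ∉ φ.source, s h = 0 := fun h hh =>
    image_eq_zero_of_notMem_tsupport fun h' => hh (hsupp h')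
  set c : ℂ := ((volume.real C ^ (-(1 / 2) : ℝ) : ℝ) : ℂ) with hc
  -- Off 𝒪 the weight is arbitrary, but s vanishes there.
  have hfW : ∀ h, f h = c * s h * ((W (ψ h) ^ (-(1 / 2) : ℝ) : ℝ) : ℂ) := by
    intro h
    by_cases hh : h ∈ φ.source
    · rw [hf, generator, hweight h hh]
    · rw [hf, generator, hs0 h hh]; simp
  have hfsupp : tsupport f ⊆ tsupport s := by
    refine closure_mono fun h hh h0 => hh ?_
    rw [hfW, h0]; simp
  have hO := φ.open_source
  have hfcont : Continuous f := by
    have hon : ContinuousOn f φ.source := by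
      have : ContinuousOn (fun h => W (ψ h)) ψ.source :=
        hWs.continuousOn.comp ψ.continuousOn fun h hh => ψ.map_source hh
      rw [funext hfW]
      refine (continuousOn_const.mul hs.continuousOn).mul
        (Complex.continuous_ofReal.comp_continuousOn ?_)
      rw [← hsrc]
      exact this.rpow_const fun h hh => Or.inl (hWpos _ (ψ.map_source hh)).ne'
    -- Continuity is only at stake on the closed support, which sits inside the open set 𝒪 where W ∘
    -- ψ is continuous and positive.
    exact continuous_of_tsupport fun h hh => hon.continuousAt (hO.mem_nhds (hsupp (hfsupp hh)))
  have hfcomp : HasCompactSupport f :=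
    hφ.isCompact_closure.of_isClosed_subset (isClosed_tsupport f)
      ((hfsupp.trans hsupp).trans subset_closure)
  refine ⟨hfcont, hfcomp, fun hsm => ?_, ?_⟩
  · refine contMDiff_of_tsupport fun h hh => ?_
    have hh' : h ∈ ψ.source := hsrc ▸ hsupp (hfsupp hh)
    have hψh := ψ.map_source hh'
    have h1 : ContDiffAt ℝ ∞ (fun ξ => ((W ξ ^ (-(1 / 2) : ℝ) : ℝ) : ℂ)) (ψ h) :=
      Complex.ofRealCLM.contDiff.contDiffAt.comp (ψ h)
        ((hWs.contDiffAt (ψ.open_target.mem_nhds hψh)).rpow_const_of_ne (hWpos _ hψh).ne')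
    rw [funext hfW]
    have h2 : ContMDiffAt 𝓘(ℝ, EH) 𝓘(ℝ, ℂ) ∞ (fun h => ((W (ψ h) ^ (-(1 / 2) : ℝ) : ℝ) : ℂ)) h :=
      h1.contMDiffAt.comp h (hψ.contMDiffOn.contMDiffAt (ψ.open_source.mem_nhds hh'))
    have h3 : ContMDiffAt 𝓘(ℝ, EH) 𝓘(ℝ, ℂ) ∞ (fun h => c * s h) h :=
      (contDiff_const.mul contDiff_id : ContDiff ℝ ∞ fun z : ℂ => c * z).contMDiff.comp hsm h
    exact (contDiff_mul.contDiffAt (x := (c * s h, _))).contMDiffAt.comp h (h3.prodMk_space h2)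
  obtain ⟨b, hb⟩ := hONB
  have hlog : ∀ κ : ΓN, lieLog (κ : N) ∈ pSpace X J := by
    intro κ
    obtain ⟨Y, hY, hYκ⟩ := hΓNsub κ.2
    rw [← hYκ, lieLog, Function.leftInverse_invFun hNbij.1]
    exact hY
  set e : ΓN → (J → ℝ) → ℂ := fun κ ξ =>
    c * Complex.exp (2 * Real.pi * Complex.I * (pairing X J ξ (lieLog (κ : N)) : ℝ)) with he
  have hec : ∀ κ, Continuous (e κ) := by
    intro κ
    have : Continuous fun ξ : J → ℝ => pairing X J ξ (lieLog (κ : N)) := by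
      unfold pairing
      fun_prop
    exact continuous_const.mul (Complex.continuous_exp.comp
      (continuous_const.mul (Complex.continuous_ofReal.comp this)))
  -- The part of the frame vector independent of ℓ: π(ℓ⁻¹κ)f is h ↦ F κ (ℓh).
  set F : ΓN → H → ℂ := fun κ h =>
    Complex.exp (2 * Real.pi * Complex.I * (betaMap lam h (lieLog (κ : N)) : ℝ)) * f h with hF
  have hFe : ∀ κ h, F κ h = e κ (ψ h) * s h * ((W (ψ h) ^ (-(1 / 2) : ℝ) : ℝ) : ℂ) := by
    intro κ h
    by_cases hh : h ∈ φ.source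
    · simp only [hF, he, hfW]
      rw [betaMap_eq_pairing_projBeta (hlog κ), ← thetaMap_apply_chart hh, ← hψθ h hh]
      ring
    · simp only [hF, hfW, hs0 h hh]; simp
  have hFsupp : ∀ κ, tsupport (F κ) ⊆ tsupport f := fun κ =>
    closure_mono fun h hh h0 => hh (by simp only [hF, h0, mul_zero])
  have hFcont : ∀ κ, Continuous (F κ) := by
    intro κ
    have hon : ContinuousOn (F κ) φ.source := by
      have h1 : ContinuousOn (fun h => e κ (ψ h)) φ.source := by
        rw [← hsrc]; exact (hec κ).comp_continuousOn ψ.continuousOn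
      have h2 : ContinuousOn (fun h => ((W (ψ h) ^ (-(1 / 2) : ℝ) : ℝ) : ℂ)) φ.source := by
        rw [← hsrc]
        exact Complex.continuous_ofReal.comp_continuousOn
          ((hWs.continuousOn.comp ψ.continuousOn fun h hh => ψ.map_source hh).rpow_const
            fun h hh => Or.inl (hWpos _ (ψ.map_source hh)).ne')
      rw [funext (hFe κ)]
      exact (h1.mul hs.continuousOn).mul h2
    exact continuous_of_tsupport fun h hh =>
      hon.continuousAt (hO.mem_nhds (hsupp (hfsupp (hFsupp κ hh))))
  have hFcomp : ∀ κ, HasCompactSupport (F κ) := fun κ =>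
    IsCompact.of_isClosed_subset hfcomp (isClosed_tsupport _) (hFsupp κ)
  have hmem : ∀ p : ΓH × ΓN, MemLp (fun h => F p.2 ((p.1 : H) * h)) 2 μ := fun p =>
    ((hFcont p.2).memLp_of_hasCompactSupport (hFcomp p.2)).comp_measurePreserving
      (measurePreserving_mul_left μ (p.1 : H))
  refine ⟨fun p => (hmem p).toLp _, fun p => ?_, fun g => ?_⟩
  · filter_upwards [(hmem p).coeFn_toLp] with h hh
    rw [hh, inducedRep_inv_mul hNsmooth hNbij]
  have hg := Lp.memLp g
  obtain ⟨hgint, hgsum⟩ := hasSum_integral_translate hs.measurable hg hsum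
  have hnorm : ‖g‖ ^ 2 = ∫ h, ‖g h‖ ^ 2 ∂μ := by
    rw [← inner_self_eq_norm_sq (𝕜 := ℂ), L2.inner_def]
    simp_rw [inner_self_eq_norm_sq_to_K]
    have : ∫ h, ((‖g h‖ : ℂ)) ^ 2 ∂μ = ((∫ h, ‖g h‖ ^ 2 ∂μ : ℝ) : ℂ) := by
      rw [← integral_complex_ofReal]
      push_cast
      rfl
    exact (congrArg Complex.re this).trans (Complex.ofReal_re _)
  rw [hnorm]
  -- For fixed ℓ the sum over κ is Parseval in L²(C); the sum over ℓ is then `hgsum`.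
  refine hasSum_prod_of_nonneg (fun p => by positivity) (fun l => ?_) hgsum
  have hgl : AEStronglyMeasurable (fun h => g ((l : H)⁻¹ * h)) μ :=
    hg.aestronglyMeasurable.comp_measurePreserving (measurePreserving_mul_left μ (l : H)⁻¹)
  have h := hasSum_sq_norm_integral_chart hWs.continuousOn hWpos hWμ (htgt ▸ hCsub) b hec hb hgl
    hs (fun h hh => hs0 h (hsrc ▸ hh)) (hgint l)
  have hin : ∀ κ : ΓN, inner ℂ g ((hmem (l, κ)).toLp _) = ∫ h, starRingEnd ℂ (g ((l : H)⁻¹ * h)) *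
        (e κ (ψ h) * s h * ((W (ψ h) ^ (-(1 / 2) : ℝ) : ℝ) : ℂ)) ∂μ := by
    intro κ
    simp_rw [← hFe]
    -- Substituting ℓh for h moves the translation from the frame vector onto g.
    rw [L2.inner_def, ← integral_mul_left_eq_self
      (fun h => starRingEnd ℂ (g ((l : H)⁻¹ * h)) * F κ h) (l : H)]
    refine integral_congr_ae ?_
    filter_upwards [(hmem (l, κ)).coeFn_toLp] with h hh
    rw [hh, RCLike.inner_apply, inv_mul_cancel_left, mul_comm]
  simpa only [hin] using h
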